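/- Let $p$ be a prime and $n\ge 0$ an integer. Rings are associative and unital, not necessarily commutative. **Power series Witt vectors with coefficients.** For a ring $R$ and an $R$-bimodule $M$ let $\widehat S(R;M)$ be the multiplicative group of power series $1+m_1t+m_2t^2+\cdots$ with $m_k\in M^{\otimes_R k}$ ($t$ central, product taken in the completed tensor algebra $\prod_{k\ge 0}M^{\otimes_R k}$), with the topology of coefficientwise convergence for discrete coefficients. Let $W(R;M)$ be the quotient of $\widehat S(R;M)$ by the closed normal subgroup generated by all commutators and all $(1-rm\,t)(1-mr\,t)^{-1}$, $r\in R$, $m\in M$. Let $W_{\langle p^n\rangle}(R;M)$ be the quotient of $W(R;M)$ by the closed subgroup generated by the classes of $1-m_1\otimes\cdots\otimes m_k\,t^k$ with $k\ge 1$, $k\notin\{1,p,\dots,p^n\}$, $m_1,\dots,m_k\in M$. It is an abelian group, written additively and functorial in $(R;M)$. For $a_0,\dots,a_n\in R$ let $\gamma(a_0,\dots,a_n)\in W_{\langle p^n\rangle}(R;R)$ be the class of $\prod_{i=0}^n(1-a_it^{p^i})$, with $a_i\in R\cong R^{\otimes_R p^i}$. **Hesselholt's Witt vectors.** For a ring $A$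 let $[A,A]$ be the additive subgroup generated by the commutators, and let $w\colon A^{m}\to (A/[A,A])^{m}$ be the ghost map, with components $w_j(a_0,\dots,a_{m-1})=\sum_{i=0}^{j}p^ia_i^{p^{j-i}}$ for $0\le j<m$. For a free ring $F$, $W_m(F)$ is the image of $w$, a subgroup of $(F/[F,F])^m$. For an arbitrary ring $R$ let $\varepsilon\colon \mathbb Z\{R\}\to R$ be the canonical surjection from the free ring on the underlying set of $R$; then $W_m(R)$ is the quotient of $W_m(\mathbb Z\{R\})$ by the subgroup generated by the differences $w(x)-w(y)$ with $x,y\in\mathbb Z\{R\}^m$ and $\varepsilon(x_i)=\varepsilon(y_i)$ for all $i$. This is an abelian group, functorial in $R$. **Claim.** 1. There are isomorphisms of abelian groups $W_{\langle p^n\rangle}(R;R)\cong W_{n+1}(R)$, one for every ring $R$, natural in $R$ with respect to ring homomorphisms. 2. There is exactly one family of biadditive products on the groups $W_{\langle p^n\rangle}(R;R)$, $R$ a commutative ring, that is natural in $R$ and makes the ghost maps $w_j\colon W_{\langle p^n\rangle}(R;R)\to R$, $\gamma(a_0,\dots,a_n)\mapsto \sum_{i=0}^{j}p^ia_i^{p^{j-i}}$,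 multiplicative for $0\le j\le n$. For every commutative ring $R$ this product makes $W_{\langle p^n\rangle}(R;R)$ a commutative ring, isomorphic as a ring to the usual ring of $p$-typical Witt vectors of $R$ of length $n+1$. -/

import Mathlib

universe u v u' v'

namespace NCWitt

open scoped PowerSeries PowerSeries.WithPiTopology

set_option linter.unusedSectionVars false

/-! ## The tensor ring of a bimodule

An `R`-bimodule is an abelian group `M` with commuting left `R`- and left `Rᵐᵒᵖ`-module
structures; the right action is `m r = op r • m`. -/

section TensorRing

variable (R : Type u) (M : Type v) [Ring R] [AddCommGroup M] [Module R M] [Module Rᵐᵒᵖ M]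
  [SMulCommClass R Rᵐᵒᵖ M]

/-- The relations defining the tensor ring `T_R(M)`: the generators `r ∈ R` form a ring, and the
generators `m ∈ M` form an `R`-bimodule over it. -/
inductive TensorRel : FreeAlgebra ℤ (R ⊕ M) → FreeAlgebra ℤ (R ⊕ M) → Prop
  | scalar_one : TensorRel (FreeAlgebra.ι ℤ (Sum.inl 1)) 1
  | scalar_mul (r s : R) : TensorRel (FreeAlgebra.ι ℤ (Sum.inl (r * s)))
      (FreeAlgebra.ι ℤ (Sum.inl r) * FreeAlgebra.ι ℤ (Sum.inl s))
  | scalar_add (r s : R) : TensorRel (FreeAlgebra.ι ℤ (Sum.inl (r + s)))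
      (FreeAlgebra.ι ℤ (Sum.inl r) + FreeAlgebra.ι ℤ (Sum.inl s))
  | vec_add (m m' : M) : TensorRel (FreeAlgebra.ι ℤ (Sum.inr (m + m')))
      (FreeAlgebra.ι ℤ (Sum.inr m) + FreeAlgebra.ι ℤ (Sum.inr m'))
  | left (r : R) (m : M) : TensorRel (FreeAlgebra.ι ℤ (Sum.inr (r • m)))
      (FreeAlgebra.ι ℤ (Sum.inl r) * FreeAlgebra.ι ℤ (Sum.inr m))
  | right (r : R) (m : M) : TensorRel (FreeAlgebra.ι ℤ (Sum.inr (MulOpposite.op r • m)))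
      (FreeAlgebra.ι ℤ (Sum.inr m) * FreeAlgebra.ι ℤ (Sum.inl r))

/-- The tensor ring `T_R(M) = ⨁ₖ M^{⊗_R k}` of the `R`-bimodule `M`: the universal ring with a ring
homomorphism from `R` and a map of `R`-bimodules from `M`. -/
def TensorRing : Type max u v := RingQuot (TensorRel R M)

noncomputable instance : Ring (TensorRing R M) := inferInstanceAs (Ring (RingQuot (TensorRel R M)))

/-- The tensor ring is discrete. -/
instance : TopologicalSpace (TensorRing R M) := ⊥

instance : DiscreteTopology (TensorRing R M) := ⟨rfl⟩

/-- The ring homomorphism `R → T_R(M)`. -/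
noncomputable def scalar : R →+* TensorRing R M where
  toFun r := RingQuot.mkRingHom (TensorRel R M) (FreeAlgebra.ι ℤ (Sum.inl r))
  map_one' := by rw [RingQuot.mkRingHom_rel TensorRel.scalar_one]; exact map_one _
  map_mul' r s := by rw [RingQuot.mkRingHom_rel (TensorRel.scalar_mul r s)]; exact map_mul _ _ _
  map_zero' := by
    have h := RingQuot.mkRingHom_rel (TensorRel.scalar_add (M := M) (0 : R) 0)
    rw [map_add, add_zero] at h
    exact left_eq_add.mp h
  map_add' r s := by rw [RingQuot.mkRingHom_rel (TensorRel.scalar_add r s)]; exact map_add _ _ _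

/-- The bimodule map `M → T_R(M)`. -/
noncomputable def vec : M →+ TensorRing R M where
  toFun m := RingQuot.mkRingHom (TensorRel R M) (FreeAlgebra.ι ℤ (Sum.inr m))
  map_zero' := by
    have h := RingQuot.mkRingHom_rel (TensorRel.vec_add (R := R) (0 : M) 0)
    rw [map_add, add_zero] at h
    exact left_eq_add.mp h
  map_add' m m' := by rw [RingQuot.mkRingHom_rel (TensorRel.vec_add m m')]; exact map_add _ _ _

variable {R M}

theorem vec_smul (r : R) (m : M) : vec R M (r • m) = scalar R M r * vec R M m :=
  (RingQuot.mkRingHom_rel (TensorRel.left r m)).trans (map_mul _ _ _)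

theorem vec_op_smul (r : R) (m : M) :
    vec R M (MulOpposite.op r • m) = vec R M m * scalar R M r :=
  (RingQuot.mkRingHom_rel (TensorRel.right r m)).trans (map_mul _ _ _)

variable (R M)

/-- The tensor power `M^{⊗_R k}`, as the degree `k` part of the tensor ring: the additive subgroup
generated by the products `r m₁ ⋯ m_k`. In particular it is `R` for `k = 0`. -/
noncomputable def tensorPower (k : ℕ) : Submodule ℤ (TensorRing R M) :=
  AddSubgroup.toIntSubmodule (scalar R M).toAddMonoidHom.range *
    AddSubgroup.toIntSubmodule (vec R M).range ^ k

variable {R M}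

/-- The elementary tensor `m₁ ⊗ ⋯ ⊗ m_k`. -/
noncomputable def elemTensor {k : ℕ} (m : Fin k → M) : TensorRing R M :=
  (List.ofFn fun i => vec R M (m i)).prod

theorem one_mem_scalar :
    (1 : Submodule ℤ (TensorRing R M)) ≤
      AddSubgroup.toIntSubmodule (scalar R M).toAddMonoidHom.range := by
  rw [Submodule.one_le]
  exact ⟨1, map_one (scalar R M)⟩

theorem elemTensor_mem {k : ℕ} (m : Fin k → M) :
    (elemTensor m : TensorRing R M) ∈ tensorPower R M k := by
  have h : (elemTensor m : TensorRing R M) ∈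
      AddSubgroup.toIntSubmodule (vec R M).range ^ k := by
    induction k with
    | zero =>
      rw [pow_zero]
      exact Submodule.one_le.mp le_rfl
    | succ k ih =>
      rw [elemTensor, List.ofFn_succ, List.prod_cons, pow_succ']
      exact Submodule.mul_mem_mul ⟨m 0, rfl⟩ (ih fun i => m i.succ)
  have h1 := Submodule.mul_mem_mul (one_mem_scalar (R := R) (M := M) (Submodule.one_le.mp le_rfl)) h
  rwa [one_mul] at h1

theorem vec_pow_mul_scalar_le (k : ℕ) :
    AddSubgroup.toIntSubmodule (vec R M).range ^ k *
        AddSubgroup.toIntSubmodule (scalar R M).toAddMonoidHom.range ≤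
      AddSubgroup.toIntSubmodule (scalar R M).toAddMonoidHom.range *
        AddSubgroup.toIntSubmodule (vec R M).range ^ k := by
  induction k with
  | zero => simp
  | succ k ih =>
    have h : AddSubgroup.toIntSubmodule (vec R M).range *
        AddSubgroup.toIntSubmodule (scalar R M).toAddMonoidHom.range ≤
        AddSubgroup.toIntSubmodule (scalar R M).toAddMonoidHom.range *
          AddSubgroup.toIntSubmodule (vec R M).range := by
      rw [Submodule.mul_le]
      rintro _ ⟨m, rfl⟩ _ ⟨r, rfl⟩
      have h1 := Submodule.mul_mem_mul
        (one_mem_scalar (R := R) (M := M) (Submodule.one_le.mp le_rfl))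
        (show vec R M (MulOpposite.op r • m) ∈ AddSubgroup.toIntSubmodule (vec R M).range
          from ⟨_, rfl⟩)
      rw [one_mul, vec_op_smul] at h1
      exact h1
    calc _ = AddSubgroup.toIntSubmodule (vec R M).range ^ k *
          (AddSubgroup.toIntSubmodule (vec R M).range *
            AddSubgroup.toIntSubmodule (scalar R M).toAddMonoidHom.range) := by
            rw [pow_succ, mul_assoc]
      _ ≤ AddSubgroup.toIntSubmodule (vec R M).range ^ k *
          (AddSubgroup.toIntSubmodule (scalar R M).toAddMonoidHom.range *
            AddSubgroup.toIntSubmodule (vec R M).range) := mul_le_mul' le_rfl h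
      _ = AddSubgroup.toIntSubmodule (vec R M).range ^ k *
          AddSubgroup.toIntSubmodule (scalar R M).toAddMonoidHom.range *
            AddSubgroup.toIntSubmodule (vec R M).range := by rw [mul_assoc]
      _ ≤ _ := mul_le_mul' ih le_rfl
      _ = _ := by rw [pow_succ, mul_assoc]

theorem mul_mem_tensorPower {i j : ℕ} {x y : TensorRing R M}
    (hx : x ∈ tensorPower R M i) (hy : y ∈ tensorPower R M j) :
    x * y ∈ tensorPower R M (i + j) := by
  have hS : AddSubgroup.toIntSubmodule (scalar R M).toAddMonoidHom.range *
      AddSubgroup.toIntSubmodule (scalar R M).toAddMonoidHom.range ≤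
      AddSubgroup.toIntSubmodule (scalar R M).toAddMonoidHom.range := by
    rw [Submodule.mul_le]
    rintro _ ⟨r, rfl⟩ _ ⟨s, rfl⟩
    exact ⟨r * s, map_mul (scalar R M) r s⟩
  have h : tensorPower R M i * tensorPower R M j ≤ tensorPower R M (i + j) := by
    unfold tensorPower
    generalize hP : AddSubgroup.toIntSubmodule (scalar R M).toAddMonoidHom.range = P at hS
    have hv := vec_pow_mul_scalar_le (R := R) (M := M) i
    rw [hP] at hv
    generalize AddSubgroup.toIntSubmodule (vec R M).range = Q at hv
    calc P * Q ^ i * (P * Q ^ j) = P * (Q ^ i * P) * Q ^ j := by simp only [mul_assoc]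
      _ ≤ P * (P * Q ^ i) * Q ^ j := mul_le_mul' (mul_le_mul' le_rfl hv) le_rfl
      _ = P * P * (Q ^ i * Q ^ j) := by simp only [mul_assoc]
      _ ≤ P * (Q ^ i * Q ^ j) := mul_le_mul' hS le_rfl
      _ = P * Q ^ (i + j) := by rw [pow_add]
  exact h (Submodule.mul_mem_mul hx hy)

theorem one_mem_tensorPower_zero : (1 : TensorRing R M) ∈ tensorPower R M 0 :=
  elemTensor_mem (R := R) (M := M) (Fin.elim0 : Fin 0 → M)

end TensorRing

/-! ## The Witt vectors with coefficients, by power series -/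

section Witt

variable (R : Type u) (M : Type v) [Ring R] [AddCommGroup M] [Module R M] [Module Rᵐᵒᵖ M]
  [SMulCommClass R Rᵐᵒᵖ M]

/-- The group of special units `Ŝ(R;M) = 1 × ∏_{k ≥ 1} M^{⊗_R k}` of the completed tensor algebra
`∏_{k ≥ 0} M^{⊗_R k}`: the power series `1 + m₁ t + m₂ t² + ⋯` with `m_k ∈ M^{⊗_R k}`, under
multiplication of power series (with `t` central). As a subgroup of a group of units it carries
the topology of coefficientwise convergence, the coefficients being discrete. -/
noncomputable def SpecialUnits : Subgroup (TensorRing R M)⟦X⟧ˣ where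
  carrier := {f | PowerSeries.coeff 0 (f : (TensorRing R M)⟦X⟧) = 1 ∧
    ∀ k, PowerSeries.coeff k (f : (TensorRing R M)⟦X⟧) ∈ tensorPower R M k}
  one_mem' := by
    refine ⟨by simp, fun k => ?_⟩
    rw [Units.val_one, PowerSeries.coeff_one]
    split_ifs with h
    · subst h; exact one_mem_tensorPower_zero
    · exact zero_mem _
  mul_mem' := by
    rintro f g ⟨hf, hf'⟩ ⟨hg, hg'⟩
    refine ⟨?_, fun k => ?_⟩
    · simp only [Units.val_mul, PowerSeries.coeff_zero_eq_constantCoeff, map_mul] at *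
      rw [hf, hg, one_mul]
    · rw [Units.val_mul, PowerSeries.coeff_mul]
      refine sum_mem fun x hx => ?_
      rw [← Finset.HasAntidiagonal.mem_antidiagonal.mp hx]
      exact mul_mem_tensorPower (hf' _) (hg' _)
  inv_mem' := by
    rintro f ⟨hf, hf'⟩
    have h0 : PowerSeries.coeff 0 ((f⁻¹ : (TensorRing R M)⟦X⟧ˣ) : (TensorRing R M)⟦X⟧) = 1 := by
      have h := congrArg (PowerSeries.coeff 0) f.mul_inv
      simp only [PowerSeries.coeff_zero_eq_constantCoeff, map_mul, map_one] at *
      rwa [hf, one_mul] at h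
    refine ⟨h0, fun k => ?_⟩
    induction k using Nat.strong_induction_on with
    | _ k ih =>
      rcases Nat.eq_zero_or_pos k with rfl | hk
      · rw [h0]; exact one_mem_tensorPower_zero
      · have h := congrArg (PowerSeries.coeff k) f.mul_inv
        rw [PowerSeries.coeff_mul, PowerSeries.coeff_one, if_neg hk.ne',
          ← Finset.add_sum_erase _ _ (show (0, k) ∈ Finset.HasAntidiagonal.antidiagonal k by simp), hf,
          one_mul] at h
        rw [eq_neg_of_add_eq_zero_left h]
        refine neg_mem (sum_mem fun x hx => ?_)
        obtain ⟨hx1, hx2⟩ := Finset.mem_erase.mp hx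
        have hx3 := Finset.HasAntidiagonal.mem_antidiagonal.mp hx2
        have hlt : x.2 < k := by
          rcases Nat.eq_zero_or_pos x.1 with h1 | h1
          · exact absurd (Prod.ext h1 (by simpa [h1] using hx3)) hx1
          · omega
        have := mul_mem_tensorPower (hf' x.1) (ih x.2 hlt)
        rwa [hx3] at this

variable {R M}

/-- The special unit `1 - x t^k`, for `k ≥ 1` and `x ∈ M^{⊗_R k}`. -/
noncomputable def oneSub (k : ℕ) (hk : k ≠ 0) (x : TensorRing R M) (hx : x ∈ tensorPower R M k) :
    SpecialUnits R M :=
  have h0 : PowerSeries.constantCoeff (1 - PowerSeries.monomial k x) =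
      ((1 : (TensorRing R M)ˣ) : TensorRing R M) := by
    rw [← PowerSeries.coeff_zero_eq_constantCoeff_apply, map_sub, PowerSeries.coeff_monomial,
      if_neg hk.symm]
    simp
  ⟨⟨1 - PowerSeries.monomial k x, PowerSeries.invOfUnit (1 - PowerSeries.monomial k x) 1,
      PowerSeries.mul_invOfUnit _ _ h0, PowerSeries.invOfUnit_mul _ _ h0⟩, by
    refine ⟨(PowerSeries.coeff_zero_eq_constantCoeff_apply _).trans h0, fun j => ?_⟩
    change PowerSeries.coeff j (1 - PowerSeries.monomial k x) ∈ _
    rw [map_sub, PowerSeries.coeff_one, PowerSeries.coeff_monomial]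
    refine sub_mem ?_ ?_
    · split_ifs with h
      · subst h; exact one_mem_tensorPower_zero
      · exact zero_mem _
    · split_ifs with h
      · subst h; exact hx
      · exact zero_mem _⟩

/-- The special unit `1 - m₁ ⊗ ⋯ ⊗ m_k t^k`. -/
noncomputable def oneSubTensor (k : ℕ) (hk : k ≠ 0) (m : Fin k → M) : SpecialUnits R M :=
  oneSub k hk (elemTensor m) (elemTensor_mem m)

/-- The Teichmüller map `τ(m) = 1 - m t`. -/
noncomputable def tau (m : M) : SpecialUnits R M :=
  oneSubTensor 1 one_ne_zero fun _ => m

variable (R M)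

/-- The closed normal subgroup of `Ŝ(R;M)` generated by the commutators and by the elements
`τ(r m) τ(m r)⁻¹`. -/
noncomputable def bigRel : Subgroup (SpecialUnits R M) :=
  (Subgroup.normalClosure
    ({x | ∃ f g : SpecialUnits R M, x = f * g * f⁻¹ * g⁻¹} ∪
      {x | ∃ (r : R) (m : M), x = tau (r • m) * (tau (MulOpposite.op r • m))⁻¹})).topologicalClosure

instance : (bigRel R M).Normal := Subgroup.is_normal_topologicalClosure _

/-- The big Witt vectors `W(R;M)` of `R` with coefficients in `M`, written multiplicatively: the
quotient of `Ŝ(R;M)^{ab}` by `τ(r m) ∼ τ(m r)` in Hausdorff topological groups. -/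
abbrev BigWitt : Type max u v := SpecialUnits R M ⧸ bigRel R M

noncomputable instance : CommGroup (BigWitt R M) where
  mul_comm x y := by
    induction x using QuotientGroup.induction_on with | _ f
    induction y using QuotientGroup.induction_on with | _ g
    rw [← QuotientGroup.mk_mul, ← QuotientGroup.mk_mul, QuotientGroup.eq]
    refine Subgroup.le_topologicalClosure _ (Subgroup.subset_normalClosure (Or.inl ?_))
    exact ⟨g⁻¹, f⁻¹, by group⟩

variable (p n : ℕ)

/-- The closed subgroup of `W(R;M)` generated by the classes of the `1 - m₁ ⊗ ⋯ ⊗ m_k t^k` with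
`k ∉ {1, p, …, p^n}`. -/
noncomputable def truncRel : Subgroup (BigWitt R M) :=
  (Subgroup.closure {x : BigWitt R M | ∃ (k : ℕ) (hk : k ≠ 0) (m : Fin k → M),
    (∀ i ≤ n, k ≠ p ^ i) ∧
      x = QuotientGroup.mk' (bigRel R M) (oneSubTensor k hk m)}).topologicalClosure

/-- The `p`-typical `(n+1)`-truncated Witt vectors `W_{⟨p^n⟩}(R;M)` of `R` with coefficients in
`M`, written additively. -/
abbrev TypicalWitt : Type max u v := Additive (BigWitt R M ⧸ truncRel R M p n)

variable {R M}

/-- The class in `W_{⟨p^n⟩}(R;M)` of a special unit. -/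
noncomputable def TypicalWitt.mk (f : SpecialUnits R M) : TypicalWitt R M p n :=
  Additive.ofMul (QuotientGroup.mk' (truncRel R M p n) (QuotientGroup.mk' (bigRel R M) f))

end Witt

/-! ## Functoriality -/

section Functoriality

/-- A morphism `(α;f) : (R;M) → (R';M')` of bimodules. -/
structure BimodHom (R : Type u) (M : Type v) [Ring R] [AddCommGroup M] [Module R M]
    [Module Rᵐᵒᵖ M] (R' : Type u') (M' : Type v') [Ring R'] [AddCommGroup M'] [Module R' M']
    [Module R'ᵐᵒᵖ M'] where
  ring : R →+* R'
  hom : M →+ M'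
  map_left : ∀ r m, hom (r • m) = ring r • hom m
  map_right : ∀ r m, hom (MulOpposite.op r • m) = MulOpposite.op (ring r) • hom m

/-- The morphism `(α;α) : (R;R) → (S;S)` given by a ring homomorphism `α`. -/
def BimodHom.ofRingHom {R : Type u} {S : Type v} [Ring R] [Ring S] (α : R →+* S) :
    BimodHom R R S S where
  ring := α
  hom := α.toAddMonoidHom
  map_left r m := by simp
  map_right r m := by simp

variable {R : Type u} {M : Type v} [Ring R] [AddCommGroup M] [Module R M] [Module Rᵐᵒᵖ M]
  [SMulCommClass R Rᵐᵒᵖ M]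
  {R' : Type u'} {M' : Type v'} [Ring R'] [AddCommGroup M'] [Module R' M'] [Module R'ᵐᵒᵖ M']
  [SMulCommClass R' R'ᵐᵒᵖ M']

/-- The induced ring homomorphism on tensor rings. -/
noncomputable def tensorMap (φ : BimodHom R M R' M') : TensorRing R M →+* TensorRing R' M' :=
  RingQuot.lift ⟨(FreeAlgebra.lift ℤ (Sum.elim (fun r => scalar R' M' (φ.ring r))
    (fun m => vec R' M' (φ.hom m)))).toRingHom, by
      intro x y h
      cases h <;> simp [φ.map_left, φ.map_right, vec_smul, vec_op_smul]⟩

@[simp] theorem tensorMap_scalar (φ : BimodHom R M R' M') (r : R) :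
    tensorMap φ (scalar R M r) = scalar R' M' (φ.ring r) := by
  refine (RingQuot.lift_mkRingHom_apply _ _ _).trans ?_
  simp

@[simp] theorem tensorMap_vec (φ : BimodHom R M R' M') (m : M) :
    tensorMap φ (vec R M m) = vec R' M' (φ.hom m) := by
  refine (RingQuot.lift_mkRingHom_apply _ _ _).trans ?_
  simp

theorem tensorMap_elemTensor (φ : BimodHom R M R' M') {k : ℕ} (m : Fin k → M) :
    tensorMap φ (elemTensor m) = elemTensor fun i => φ.hom (m i) := by
  simp [elemTensor, map_list_prod, List.map_ofFn, Function.comp_def]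

theorem tensorMap_mem (φ : BimodHom R M R' M') {k : ℕ} {x : TensorRing R M}
    (hx : x ∈ tensorPower R M k) : tensorMap φ x ∈ tensorPower R' M' k := by
  have h : tensorPower R M k ≤
      (tensorPower R' M' k).comap (tensorMap φ).toAddMonoidHom.toIntLinearMap := by
    have hv : ∀ j : ℕ, ∀ y ∈ AddSubgroup.toIntSubmodule (vec R M).range ^ j,
        tensorMap φ y ∈ AddSubgroup.toIntSubmodule (vec R' M').range ^ j := by
      intro j
      induction j with
      | zero =>
        intro y hy
        rw [pow_zero, Submodule.mem_one] at *
        obtain ⟨z, rfl⟩ := hy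
        exact ⟨z, by simp⟩
      | succ j ih =>
        intro y hy
        rw [pow_succ] at *
        induction hy using Submodule.mul_induction_on' with
        | mem_mul_mem a ha b hb =>
          obtain ⟨m, rfl⟩ := hb
          rw [map_mul]
          exact Submodule.mul_mem_mul (ih a ha) ⟨φ.hom m, (tensorMap_vec φ m).symm⟩
        | add a _ b _ ha hb => rw [map_add]; exact add_mem ha hb
    rw [tensorPower, Submodule.mul_le]
    rintro _ ⟨r, rfl⟩ y hy
    change tensorMap φ (scalar R M r * y) ∈ tensorPower R' M' k
    rw [map_mul, tensorMap_scalar]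
    exact Submodule.mul_mem_mul ⟨φ.ring r, rfl⟩ (hv k y hy)
  exact h hx

/-- The induced homomorphism on special units, applied coefficientwise. -/
noncomputable def unitsMap (φ : BimodHom R M R' M') : SpecialUnits R M →* SpecialUnits R' M' :=
  ((Units.map (PowerSeries.map (tensorMap φ)).toMonoidHom).comp (SpecialUnits R M).subtype).codRestrict
    (SpecialUnits R' M') fun f => by
      refine ⟨?_, fun k => ?_⟩
      · change PowerSeries.coeff 0 (PowerSeries.map (tensorMap φ) f.1) = 1
        rw [PowerSeries.coeff_map, f.2.1, map_one]
      · change PowerSeries.coeff k (PowerSeries.map (tensorMap φ) f.1) ∈ _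
        rw [PowerSeries.coeff_map]
        exact tensorMap_mem φ (f.2.2 k)

theorem continuous_unitsMap (φ : BimodHom R M R' M') : Continuous (unitsMap φ) := by
  refine Continuous.subtype_mk ?_ _
  refine (Continuous.units_map _ ?_).comp continuous_subtype_val
  change Continuous (MvPowerSeries.map (tensorMap φ))
  refine continuous_pi fun d => ?_
  have h : Continuous fun f : MvPowerSeries Unit (TensorRing R M) => f d := continuous_apply d
  exact (continuous_of_discreteTopology (f := tensorMap φ)).comp h

theorem unitsMap_oneSubTensor (φ : BimodHom R M R' M') (k : ℕ) (hk : k ≠ 0) (m : Fin k → M) :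
    unitsMap φ (oneSubTensor k hk m) = oneSubTensor k hk fun i => φ.hom (m i) := by
  refine Subtype.ext (Units.ext ?_)
  change PowerSeries.map (tensorMap φ) (1 - PowerSeries.monomial k (elemTensor m)) =
    1 - PowerSeries.monomial k (elemTensor fun i => φ.hom (m i))
  rw [map_sub, map_one]
  congr 1
  ext j
  rw [PowerSeries.coeff_map, PowerSeries.coeff_monomial, PowerSeries.coeff_monomial,
    ← tensorMap_elemTensor]
  split_ifs <;> simp

theorem bigRel_le (φ : BimodHom R M R' M') : bigRel R M ≤ (bigRel R' M').comap (unitsMap φ) := by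
  refine Subgroup.topologicalClosure_minimal _ ?_
    ((Subgroup.isClosed_topologicalClosure _).preimage (continuous_unitsMap φ))
  refine Subgroup.normalClosure_le_normal ?_
  rintro _ (⟨f, g, rfl⟩ | ⟨r, m, rfl⟩)
  · refine Subgroup.le_topologicalClosure _ (Subgroup.subset_normalClosure (Or.inl ?_))
    exact ⟨unitsMap φ f, unitsMap φ g, by simp⟩
  · refine Subgroup.le_topologicalClosure _ (Subgroup.subset_normalClosure (Or.inr ?_))
    refine ⟨φ.ring r, φ.hom m, ?_⟩
    simp [tau, unitsMap_oneSubTensor, φ.map_left, φ.map_right]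

/-- The induced homomorphism `W(R;M) → W(R';M')`. -/
noncomputable def bigMap (φ : BimodHom R M R' M') : BigWitt R M →* BigWitt R' M' :=
  QuotientGroup.map _ _ (unitsMap φ) (bigRel_le φ)

theorem continuous_bigMap (φ : BimodHom R M R' M') : Continuous (bigMap φ) :=
  Continuous.quotient_lift (QuotientGroup.continuous_mk.comp (continuous_unitsMap φ)) _

theorem truncRel_le (φ : BimodHom R M R' M') (p n : ℕ) :
    truncRel R M p n ≤ (truncRel R' M' p n).comap (bigMap φ) := by
  refine Subgroup.topologicalClosure_minimal _ ?_
    ((Subgroup.isClosed_topologicalClosure _).preimage (continuous_bigMap φ))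
  rw [Subgroup.closure_le]
  rintro _ ⟨k, hk, m, hkp, rfl⟩
  refine Subgroup.le_topologicalClosure _ (Subgroup.subset_closure ?_)
  refine ⟨k, hk, fun i => φ.hom (m i), hkp, ?_⟩
  rw [← unitsMap_oneSubTensor]
  rfl

/-- The induced homomorphism `W_{⟨p^n⟩}(R;M) → W_{⟨p^n⟩}(R';M')`. -/
noncomputable def TypicalWitt.map (p n : ℕ) (φ : BimodHom R M R' M') :
    TypicalWitt R M p n →+ TypicalWitt R' M' p n :=
  MonoidHom.toAdditive (QuotientGroup.map _ _ (bigMap φ) (truncRel_le φ p n))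

end Functoriality

/-! ## Hesselholt's Witt vectors of a non-commutative ring -/

section Hesselholt

/-- The additive subgroup `[A,A]` of a ring generated by the commutators. -/
def commutators (A : Type u) [Ring A] : AddSubgroup A :=
  AddSubgroup.closure {z | ∃ x y : A, z = x * y - y * x}

/-- The Witt polynomial `∑_{i ≤ j} p^i a_i^{p^{j-i}}`. -/
def wittPoly (p : ℕ) {A : Type u} [Ring A] {m : ℕ} (a : Fin m → A) (j : Fin m) : A :=
  ∑ i ∈ Finset.Iic j, (p : A) ^ (i : ℕ) * a i ^ p ^ ((j : ℕ) - (i : ℕ))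

/-- The ghost map `A^m → (A/[A,A])^m`. -/
def ghost (p m : ℕ) (A : Type u) [Ring A] (a : Fin m → A) : Fin m → A ⧸ commutators A :=
  fun j => QuotientAddGroup.mk (wittPoly p a j)

/-- The subgroup of `(A/[A,A])^m` generated by the image of the ghost map. For a free ring `A` and
`p` prime the image is already a subgroup; it is the group of Witt vectors of length `m` of the
free ring `A`, on which the ghost map is injective. -/
def ghostImage (p m : ℕ) (A : Type u) [Ring A] : AddSubgroup (Fin m → A ⧸ commutators A) :=
  AddSubgroup.closure (Set.range (ghost p m A))

/-- The canonical surjection `ℤ{R} → R` from the free ring on the underlying set of `R`. -/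
noncomputable def counit (R : Type u) [Ring R] : FreeAlgebra ℤ R →+* R :=
  (FreeAlgebra.lift ℤ (id : R → R)).toRingHom

/-- The subgroup identifying the Witt vectors of two sequences over `ℤ{R}` that have the same
image over `R`. -/
noncomputable def presentationRel (p m : ℕ) (R : Type u) [Ring R] :
    AddSubgroup (ghostImage p m (FreeAlgebra ℤ R)) :=
  AddSubgroup.closure {d | ∃ x y : Fin m → FreeAlgebra ℤ R,
    (∀ i, counit R (x i) = counit R (y i)) ∧
    (d : Fin m → FreeAlgebra ℤ R ⧸ commutators (FreeAlgebra ℤ R)) =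
      ghost p m (FreeAlgebra ℤ R) x - ghost p m (FreeAlgebra ℤ R) y}

/-- Hesselholt's group `W_m(R)` of `p`-typical Witt vectors of length `m` of a ring `R`, not
necessarily commutative. On free rings it is the quotient of the set of sequences of length `m`
that makes the ghost map injective, with the addition for which the ghost map is additive; it is
extended to all rings by reflexive coequalisers, here along the canonical free presentation
`ℤ{R} → R`: two sequences over `ℤ{R}` are identified when they agree over `R`. -/
def HesselholtWitt (p m : ℕ) (R : Type u) [Ring R] : Type u :=
  ghostImage p m (FreeAlgebra ℤ R) ⧸ presentationRel p m R

noncomputable instance (p m : ℕ) (R : Type u) [Ring R] : AddCommGroup (HesselholtWitt p m R) :=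
  inferInstanceAs (AddCommGroup (ghostImage p m (FreeAlgebra ℤ R) ⧸ presentationRel p m R))

variable {A : Type u} {B : Type v} [Ring A] [Ring B]

theorem commutators_le (f : A →+* B) : commutators A ≤ (commutators B).comap f.toAddMonoidHom := by
  rw [commutators, AddSubgroup.closure_le]
  rintro _ ⟨x, y, rfl⟩
  exact AddSubgroup.subset_closure ⟨f x, f y, by simp⟩

/-- The map `(A/[A,A])^m → (B/[B,B])^m` induced by a ring homomorphism. -/
def ghostTargetMap (m : ℕ) (f : A →+* B) :
    (Fin m → A ⧸ commutators A) →+ (Fin m → B ⧸ commutators B) :=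
  (QuotientAddGroup.map _ _ f.toAddMonoidHom (commutators_le f)).compLeft (Fin m)

theorem ghostTargetMap_ghost (p m : ℕ) (f : A →+* B) (a : Fin m → A) :
    ghostTargetMap m f (ghost p m A a) = ghost p m B fun i => f (a i) := by
  funext j
  change (QuotientAddGroup.mk (f (wittPoly p a j)) : B ⧸ commutators B) = QuotientAddGroup.mk _
  simp [wittPoly]

/-- The map induced on the subgroups generated by the ghost images. -/
def ghostImageMap (p m : ℕ) (f : A →+* B) : ghostImage p m A →+ ghostImage p m B :=
  ((ghostTargetMap m f).comp (ghostImage p m A).subtype).codRestrict (ghostImage p m B) fun x => by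
    have h : ghostImage p m A ≤ (ghostImage p m B).comap (ghostTargetMap m f) := by
      rw [ghostImage, AddSubgroup.closure_le]
      rintro _ ⟨a, rfl⟩
      exact AddSubgroup.subset_closure ⟨fun i => f (a i), (ghostTargetMap_ghost p m f a).symm⟩
    exact h x.2

/-- The ring homomorphism `ℤ{A} → ℤ{B}` induced by `f : A → B`. -/
noncomputable def freeMap (f : A →+* B) : FreeAlgebra ℤ A →+* FreeAlgebra ℤ B :=
  (FreeAlgebra.lift ℤ fun a => FreeAlgebra.ι ℤ (f a)).toRingHom

theorem counit_freeMap (f : A →+* B) (x : FreeAlgebra ℤ A) :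
    counit B (freeMap f x) = f (counit A x) := by
  have h : (FreeAlgebra.lift ℤ (id : B → B)).comp
      (FreeAlgebra.lift ℤ fun a : A => FreeAlgebra.ι ℤ (f a)) =
      f.toIntAlgHom.comp (FreeAlgebra.lift ℤ (id : A → A)) := by
    ext a
    simp
  exact congrArg (fun g => g x) h

/-- The homomorphism `W_m(A) → W_m(B)` induced by a ring homomorphism. -/
noncomputable def HesselholtWitt.map (p m : ℕ) (f : A →+* B) :
    HesselholtWitt p m A →+ HesselholtWitt p m B :=
  QuotientAddGroup.map _ _ (ghostImageMap p m (freeMap f)) <| by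
    rw [presentationRel, AddSubgroup.closure_le]
    rintro d ⟨x, y, hxy, hd⟩
    refine AddSubgroup.subset_closure ⟨fun i => freeMap f (x i), fun i => freeMap f (y i),
      fun i => by rw [counit_freeMap, counit_freeMap, hxy], ?_⟩
    change ghostTargetMap m (freeMap f) d.1 = _
    rw [hd, map_sub, ghostTargetMap_ghost, ghostTargetMap_ghost]

end Hesselholt

/-! ## The product of Witt vectors for commutative rings -/

section Product

/-- The class `γ(a₀,…,a_n)` of `∏_{i ≤ n} (1 - a_i t^{p^i})` in `W_{⟨p^n⟩}(R;R)`, where `a_i ∈ R` is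
viewed in `R^{⊗_R p^i} ≅ R` as `a_i ⊗ 1 ⊗ ⋯ ⊗ 1`. -/
noncomputable def wittCoord (p n : ℕ) [hp : Fact p.Prime] {R : Type u} [Ring R]
    (a : Fin (n + 1) → R) : TypicalWitt R R p n :=
  ∑ i : Fin (n + 1), TypicalWitt.mk p n
    (oneSubTensor (p ^ (i : ℕ)) (pow_ne_zero _ hp.out.ne_zero)
      fun l => if (l : ℕ) = 0 then a i else 1)

/-- The product on the groups `W_{⟨p^n⟩}(R;R)`, for `R` a commutative ring, that is given by their
monoidal structure: it is biadditive, natural in `R`, and it makes the ghost maps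
`w_j : W_{⟨p^n⟩}(R;R) → R`, which send `γ(a₀,…,a_n)` to `∑_{i ≤ j} p^i a_i^{p^{j-i}}`,
multiplicative. -/
structure IsWittProduct (p n : ℕ) [Fact p.Prime]
    (μ : ∀ (R : Type u) [CommRing R],
      TypicalWitt R R p n →+ TypicalWitt R R p n →+ TypicalWitt R R p n) : Prop where
  natural : ∀ (R S : Type u) [CommRing R] [CommRing S] (f : R →+* S) (x y : TypicalWitt R R p n),
    TypicalWitt.map p n (BimodHom.ofRingHom f) (μ R x y) =
      μ S (TypicalWitt.map p n (BimodHom.ofRingHom f) x)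
        (TypicalWitt.map p n (BimodHom.ofRingHom f) y)
  ghost_mul : ∀ (R : Type u) [CommRing R] (a b c : Fin (n + 1) → R),
    μ R (wittCoord p n a) (wittCoord p n b) = wittCoord p n c →
      ∀ j, wittPoly p a j * wittPoly p b j = wittPoly p c j

end Product

end NCWitt

/-! For the bimodule `R` every tensor power is a copy of `R`, so the special units are the group 1 +
t R⟦t⟧. The subgroup generated by the relations and the tail 1 + t^(p^n+1) R⟦t⟧ is open, hence
closed. The topological closures in the definition therefore disappear, and the Witt group becomes a
purely algebraic quotient (`wittClass_eq_zero_iff`). Removing leading coefficients one degree at a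
time writes every class as γ(a₀,…,a_n), and a series congruent to 1 modulo an ideal gets coordinates
in that ideal (`exists_wittCoord_of_map_eq_one`). Hence for a surjection R → S with kernel I the
Witt group of S is that of R modulo the elements with coordinates in I (`map_eq_zero_iff`). The
logarithmic derivative, taken modulo commutators, kills all the relations and sends γ(a) to the Witt
polynomials of a. This gives an additive ghost map (`wittGhost_wittCoord`), injective whenever
R/[R,R] has no p-torsion (`wittGhost_injective`). A free ring has this property, since modulo
commutators only the cyclic word of a monomial matters. Over ℤ{R} the Witt group is thus the image
of the ghost map, which is Hesselholt's group, and both groups pass to R by the same quotient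
(`exists_addEquiv_hesselholtWitt`). For commutative R the same argument over the polynomial ring
ℤ[R], where Witt polynomials determine coordinates, compares with the usual truncated Witt vectors
(`exists_addEquiv_truncatedWittVector`). The product is transported from there. It is unique because
naturality reduces any product to ℤ[R], where the ghost components force its value. -/

namespace NCWitt

open scoped PowerSeries PowerSeries.WithPiTopology

/-! ## Power series with constant coefficient one -/

section OneUnits

variable {A : Type u} {B : Type v} [Ring A] [Ring B]

/-- The group `1 + t A⟦t⟧`. -/
noncomputable def OneUnits (A : Type u) [Ring A] : Subgroup A⟦X⟧ˣ :=
  (Units.map (PowerSeries.constantCoeff (R := A)).toMonoidHom).ker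

theorem mem_oneUnits {f : A⟦X⟧ˣ} :
    f ∈ OneUnits A ↔ PowerSeries.constantCoeff (f : A⟦X⟧) = 1 := by
  rw [OneUnits, MonoidHom.mem_ker, Units.ext_iff]
  rfl

namespace OneUnits

/-- The power series underlying an element of `1 + t A⟦t⟧`. -/
noncomputable def ser (f : OneUnits A) : A⟦X⟧ := (f.1 : A⟦X⟧)

theorem ser_injective : Function.Injective (ser : OneUnits A → A⟦X⟧) :=
  fun _ _ h => Subtype.ext (Units.ext h)

@[simp] theorem ser_mul (f g : OneUnits A) : (ser (f * g)) = (ser f) * (ser g) := rfl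

@[simp] theorem ser_one : (ser (1 : OneUnits A)) = 1 := rfl

@[simp] theorem ser_mul_ser_inv (f : OneUnits A) : (ser f) * (ser (f⁻¹)) = 1 := by
  rw [← ser_mul, mul_inv_cancel, ser_one]

@[simp] theorem ser_inv_mul_ser (f : OneUnits A) : (ser (f⁻¹)) * (ser f) = 1 := by
  rw [← ser_mul, inv_mul_cancel, ser_one]

@[simp] theorem constantCoeff_ser (f : OneUnits A) : PowerSeries.constantCoeff (ser f) = 1 :=
  mem_oneUnits.mp f.2

/-- A power series with constant coefficient one as an element of `1 + t A⟦t⟧`. -/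
noncomputable def ofSeries (f : A⟦X⟧) (h : PowerSeries.constantCoeff f = 1) : OneUnits A :=
  ⟨⟨f, PowerSeries.invOfUnit f 1, PowerSeries.mul_invOfUnit _ _ h,
    PowerSeries.invOfUnit_mul _ _ h⟩, mem_oneUnits.mpr h⟩

@[simp] theorem ser_ofSeries (f : A⟦X⟧) (h : PowerSeries.constantCoeff f = 1) :
    (ser (ofSeries f h)) = f := rfl

/-- The element `1 - a t^k` of `1 + t A⟦t⟧`, for `k ≥ 1`. -/
noncomputable def binom (k : ℕ) (hk : k ≠ 0) (a : A) : OneUnits A :=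
  ofSeries (1 - PowerSeries.monomial k a) (by
    rw [← PowerSeries.coeff_zero_eq_constantCoeff_apply, map_sub, PowerSeries.coeff_monomial,
      if_neg hk.symm]
    simp)

@[simp] theorem ser_binom (k : ℕ) (hk : k ≠ 0) (a : A) :
    (ser (binom k hk a)) = 1 - PowerSeries.monomial k a := rfl

@[simp] theorem binom_zero (k : ℕ) (hk : k ≠ 0) : binom k hk (0 : A) = 1 :=
  ser_injective (by simp)

/-- The homomorphism `1 + t A⟦t⟧ → 1 + t B⟦t⟧` induced by a ring homomorphism. -/
noncomputable def map (φ : A →+* B) : OneUnits A →* OneUnits B :=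
  ((Units.map (PowerSeries.map φ).toMonoidHom).comp (OneUnits A).subtype).codRestrict _ fun f => by
    rw [mem_oneUnits]
    change PowerSeries.constantCoeff (PowerSeries.map φ (ser f)) = 1
    rw [← PowerSeries.coeff_zero_eq_constantCoeff_apply, PowerSeries.coeff_map]
    simp

@[simp] theorem ser_map (φ : A →+* B) (f : OneUnits A) :
    (ser (map φ f)) = PowerSeries.map φ (ser f) := rfl

theorem map_binom (φ : A →+* B) (k : ℕ) (hk : k ≠ 0) (a : A) :
    map φ (binom k hk a) = binom k hk (φ a) := by
  refine ser_injective ?_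
  rw [ser_map, ser_binom, ser_binom, map_sub, map_one]
  congr 1
  ext j
  rw [PowerSeries.coeff_map, PowerSeries.coeff_monomial, PowerSeries.coeff_monomial]
  split_ifs <;> simp

/-- The subgroup `1 + t^m A⟦t⟧`. -/
noncomputable def fil (A : Type u) [Ring A] (m : ℕ) : Subgroup (OneUnits A) where
  carrier := {f | PowerSeries.X ^ m ∣ (ser f) - 1}
  one_mem' := by simp
  mul_mem' {f g} hf hg := by
    have h : (ser (f * g)) - 1 = ((ser f) - 1) * (ser g) + ((ser g) - 1) := by
      rw [ser_mul]; noncomm_ring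
    rw [Set.mem_ofPred_eq, h]
    exact dvd_add (hf.mul_right _) hg
  inv_mem' {f} hf := by
    have h : (ser (f⁻¹)) - 1 = -(((ser f) - 1) * (ser (f⁻¹))) := by
      rw [sub_mul, ser_mul_ser_inv, one_mul, neg_sub]
    rw [Set.mem_ofPred_eq, h]
    exact (hf.mul_right _).neg_right

theorem mem_fil {m : ℕ} {f : OneUnits A} : f ∈ fil A m ↔ PowerSeries.X ^ m ∣ (ser f) - 1 := Iff.rfl

theorem mem_fil_iff {m : ℕ} {f : OneUnits A} :
    f ∈ fil A m ↔ ∀ k, k ≠ 0 → k < m → PowerSeries.coeff k (ser f) = 0 := by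
  rw [mem_fil, PowerSeries.X_pow_dvd_iff]
  refine ⟨fun h k hk hkm => ?_, fun h k hkm => ?_⟩
  · have := h k hkm
    rwa [map_sub, PowerSeries.coeff_one, if_neg hk, sub_zero] at this
  · rcases eq_or_ne k 0 with rfl | hk
    · simp
    · rw [map_sub, PowerSeries.coeff_one, if_neg hk, sub_zero, h k hk hkm]

theorem mem_fil_one (f : OneUnits A) : f ∈ fil A 1 :=
  mem_fil_iff.mpr fun _ hk hk1 => absurd (Nat.lt_one_iff.mp hk1) hk

/-- Coefficients are lifted one by one. Lifting zero to zero, and the constant coefficient to 1,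
keeps the lift in the filtration. -/
theorem exists_mem_fil_map_eq {φ : A →+* B} (hφ : Function.Surjective φ) {m : ℕ}
    {g : OneUnits B} (hg : g ∈ fil B m) : ∃ f ∈ fil A m, map φ f = g := by
  classical
  choose s hs using hφ
  let f : OneUnits A := ofSeries (PowerSeries.mk fun k => if k = 0 then 1 else
      if PowerSeries.coeff k (ser g) = 0 then 0 else s (PowerSeries.coeff k (ser g))) (by
    rw [← PowerSeries.coeff_zero_eq_constantCoeff_apply, PowerSeries.coeff_mk, if_pos rfl])
  refine ⟨f, mem_fil_iff.mpr fun k hk hkm => ?_, ser_injective (PowerSeries.ext fun k => ?_)⟩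
  · rw [ser_ofSeries, PowerSeries.coeff_mk, if_neg hk, if_pos (mem_fil_iff.mp hg k hk hkm)]
  · rw [ser_map, ser_ofSeries, PowerSeries.coeff_map, PowerSeries.coeff_mk]
    split_ifs with h h'
    · subst h
      simp
    · rw [map_zero, h']
    · exact hs _

theorem map_surjective {φ : A →+* B} (hφ : Function.Surjective φ) :
    Function.Surjective (map φ) := fun g =>
  let ⟨f, _, hf⟩ := exists_mem_fil_map_eq hφ (mem_fil_one g)
  ⟨f, hf⟩

theorem mem_fil_succ {m : ℕ} (hm : m ≠ 0) {f : OneUnits A} :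
    f ∈ fil A (m + 1) ↔ f ∈ fil A m ∧ PowerSeries.coeff m (ser f) = 0 := by
  simp only [mem_fil_iff]
  refine ⟨fun h => ⟨fun k hk hkm => h k hk (by omega), h m hm (by omega)⟩, fun h k hk hkm => ?_⟩
  rcases Nat.lt_succ_iff_lt_or_eq.mp hkm with h1 | rfl
  · exact h.1 k hk h1
  · exact h.2

/-- The difference fg - (f + g - 1) is (f - 1)(g - 1), which is divisible by t^(2m) and so is
invisible in degree m ≥ 1. -/
theorem coeff_mul_of_mem_fil {m : ℕ} (hm : m ≠ 0) {f g : OneUnits A} (hf : f ∈ fil A m)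
    (hg : g ∈ fil A m) : PowerSeries.coeff m (ser (f * g)) =
      PowerSeries.coeff m (ser f) + PowerSeries.coeff m (ser g) := by
  obtain ⟨c, hc⟩ := hf
  obtain ⟨d, hd⟩ := hg
  have h : (ser (f * g)) = (ser f) + (ser g) - 1 + PowerSeries.X ^ (m + m) * (c * d) := by
    have h1 : PowerSeries.X ^ (m + m) * (c * d) = ((ser f) - 1) * ((ser g) - 1) := by
      rw [hc, hd, mul_assoc, ← mul_assoc c, (PowerSeries.commute_X_pow c m).eq, pow_add]
      simp only [mul_assoc]
    rw [h1, ser_mul]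
    noncomm_ring
  rw [h, map_add, map_sub, map_add, PowerSeries.coeff_one, if_neg hm, sub_zero,
    PowerSeries.coeff_X_pow_mul', if_neg (by omega), add_zero]

theorem coeff_inv_of_mem_fil {m : ℕ} (hm : m ≠ 0) {f : OneUnits A} (hf : f ∈ fil A m) :
    PowerSeries.coeff m (ser (f⁻¹)) = -PowerSeries.coeff m (ser f) := by
  have h := coeff_mul_of_mem_fil hm hf (inv_mem hf)
  rw [mul_inv_cancel, ser_one, PowerSeries.coeff_one, if_neg hm] at h
  exact (neg_eq_of_add_eq_zero_right h.symm).symm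

theorem binom_mem_fil (k : ℕ) (hk : k ≠ 0) (a : A) : binom k hk a ∈ fil A k := by
  refine mem_fil_iff.mpr fun j hj hjk => ?_
  rw [ser_binom, map_sub, PowerSeries.coeff_one, if_neg hj, PowerSeries.coeff_monomial,
    if_neg hjk.ne, sub_zero]

theorem coeff_binom (k : ℕ) (hk : k ≠ 0) (a : A) :
    PowerSeries.coeff k (ser (binom k hk a)) = -a := by
  rw [ser_binom, map_sub, PowerSeries.coeff_one, if_neg hk, PowerSeries.coeff_monomial,
    if_pos rfl, zero_sub]

/-- This is the step of every successive approximation below: dividing by a series with the same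
leading coefficient raises the order. -/
theorem mul_inv_mem_fil_succ {m : ℕ} (hm : m ≠ 0) {f g : OneUnits A} (hf : f ∈ fil A m)
    (hg : g ∈ fil A m) (h : PowerSeries.coeff m (ser f) = PowerSeries.coeff m (ser g)) :
    f * g⁻¹ ∈ fil A (m + 1) := by
  rw [mem_fil_succ hm]
  refine ⟨mul_mem hf (inv_mem hg), ?_⟩
  rw [coeff_mul_of_mem_fil hm hf (inv_mem hg), coeff_inv_of_mem_fil hm hg, h, add_neg_cancel]

theorem fil_anti {m m' : ℕ} (h : m ≤ m') : fil A m' ≤ fil A m := fun _ hf =>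
  (pow_dvd_pow _ h).trans hf

/-- Modulo the commutator subgroup, `1 - x y ∼ 1 - y x` for `x, y` without constant term. -/
theorem one_sub_mul_comm (G : Type*) [CommGroup G] (q : OneUnits A →* G) {u v f g : OneUnits A}
    (hf : (ser f) = 1 - ((ser v) - 1) * ((ser u) - 1)) (hg : (ser g) = 1 - ((ser u) - 1) * ((ser v) - 1)) :
    q f = q g := by
  -- Here f = u + v - vu and g = u + v - uv, so both sides equal u + u v⁻¹ u - u². In a commutative
  -- quotient the factors u and v⁻¹ cancel.
  have h : u * v⁻¹ * f = g * v⁻¹ * u := by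
    refine ser_injective ?_
    have h1 := ser_mul_ser_inv v
    have h2 := ser_inv_mul_ser v
    simp only [ser_mul, hf, hg]
    calc (ser u) * (ser (v⁻¹)) * (1 - ((ser v) - 1) * ((ser u) - 1))
        = (ser u) * (ser (v⁻¹)) * (ser u) - (ser u) * ((ser (v⁻¹)) * (ser v)) * ((ser u) - 1) := by noncomm_ring
      _ = (ser u) * (ser (v⁻¹)) * (ser u) - ((ser u) - 1) * ((ser v) * (ser (v⁻¹))) * (ser u) := by
          rw [h1, h2]; noncomm_ring
      _ = _ := by noncomm_ring
  have h3 := congrArg q h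
  simp only [map_mul, map_inv] at h3
  rw [mul_comm (q u), mul_comm (q g), mul_right_comm] at h3
  rw [mul_right_comm] at h3
  exact mul_left_cancel (a := (q v)⁻¹ * q u) (by rw [h3]; ac_rfl)

/-- For k ≥ 2 one splits t^k = t · t^(k-1) and applies `one_sub_mul_comm` to 1 - s t^(k-1) and 1 - r
t. For k = 1 one factor would have degree 0, which is why that case has to be imposed as a relation.
-/
theorem map_binom_mul_comm (G : Type*) [CommGroup G] (q : OneUnits A →* G)
    (hq : ∀ r s : A, q (binom 1 one_ne_zero (r * s)) = q (binom 1 one_ne_zero (s * r)))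
    (k : ℕ) (hk : k ≠ 0) (r s : A) : q (binom k hk (r * s)) = q (binom k hk (s * r)) := by
  obtain ⟨j, rfl⟩ := Nat.exists_eq_succ_of_ne_zero hk
  rcases Nat.eq_zero_or_pos j with rfl | hj
  · exact hq r s
  · refine one_sub_mul_comm G q (u := binom j hj.ne' s) (v := binom 1 one_ne_zero r) ?_ ?_
    · simp [PowerSeries.monomial_mul_monomial, add_comm]
    · simp [PowerSeries.monomial_mul_monomial]

end OneUnits

end OneUnits

/-! ## The logarithmic derivative modulo commutators -/

section LogDeriv

variable {A : Type u} {B : Type v} [Ring A] [Ring B]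

/-- The class of an element modulo commutators. -/
noncomputable def trace (A : Type u) [Ring A] : A →+ A ⧸ commutators A := QuotientAddGroup.mk' _

theorem trace_mul_comm (x y : A) : trace A (x * y) = trace A (y * x) := by
  rw [← sub_eq_zero, ← map_sub]
  exact (QuotientAddGroup.eq_zero_iff _).mpr (AddSubgroup.subset_closure ⟨x, y, rfl⟩)

theorem trace_eq_zero {x : A} : trace A x = 0 ↔ x ∈ commutators A :=
  QuotientAddGroup.eq_zero_iff _

theorem trace_coeff_mul_comm (k : ℕ) (f g : A⟦X⟧) :
    trace A (PowerSeries.coeff k (f * g)) = trace A (PowerSeries.coeff k (g * f)) := by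
  rw [PowerSeries.coeff_mul, PowerSeries.coeff_mul, map_sum, map_sum,
    ← Finset.Nat.sum_antidiagonal_swap]
  exact Finset.sum_congr rfl fun x _ => trace_mul_comm _ _

/-- The derivation `t d/dt`. -/
noncomputable def eulerDeriv (f : A⟦X⟧) : A⟦X⟧ := PowerSeries.mk fun k => k • PowerSeries.coeff k f

theorem eulerDeriv_mul (f g : A⟦X⟧) :
    eulerDeriv (f * g) = eulerDeriv f * g + f * eulerDeriv g := by
  ext k
  simp only [eulerDeriv, PowerSeries.coeff_mk, map_add, PowerSeries.coeff_mul, Finset.smul_sum]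
  rw [← Finset.sum_add_distrib]
  refine Finset.sum_congr rfl fun x hx => ?_
  rw [← Finset.HasAntidiagonal.mem_antidiagonal.mp hx, add_smul, smul_mul_assoc, mul_smul_comm]

namespace OneUnits

/-- The coefficients of `-t f' f⁻¹` modulo commutators. -/
noncomputable def logDeriv (k : ℕ) : Additive (OneUnits A) →+ A ⧸ commutators A where
  toFun f := -trace A (PowerSeries.coeff k (eulerDeriv (ser f.toMul) * (ser (f.toMul⁻¹))))
  map_zero' := by
    have h : eulerDeriv (1 : A⟦X⟧) = 0 := by
      ext k
      rw [eulerDeriv, PowerSeries.coeff_mk, PowerSeries.coeff_one]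
      split_ifs with h <;> simp [h]
    simp [h]
  map_add' f g := by
    -- By the Leibniz rule the second summand is the logarithmic derivative of g conjugated by f.
    -- The trace does not see the conjugation.
    have h : eulerDeriv (ser (f + g).toMul) * (ser ((f + g).toMul⁻¹)) =
        eulerDeriv (ser f.toMul) * ((ser g.toMul) * (ser (g.toMul⁻¹))) * (ser (f.toMul⁻¹)) +
        (ser f.toMul) * (eulerDeriv (ser g.toMul) * (ser (g.toMul⁻¹)) * (ser (f.toMul⁻¹))) := by
      rw [toMul_add, mul_inv_rev, ser_mul, ser_mul, eulerDeriv_mul]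
      noncomm_ring
    rw [h, ser_mul_ser_inv, mul_one, map_add, map_add, neg_add, trace_coeff_mul_comm k (ser f.toMul),
      mul_assoc _ (ser (f.toMul⁻¹)), ser_inv_mul_ser, mul_one]

theorem logDeriv_of_mem_fil {m k : ℕ} (hkm : k < m) {f : OneUnits A} (hf : f ∈ fil A m) :
    logDeriv k (Additive.ofMul f) = 0 := by
  have h : PowerSeries.X ^ m ∣ eulerDeriv (ser f) := by
    rw [PowerSeries.X_pow_dvd_iff]
    intro j hj
    rw [eulerDeriv, PowerSeries.coeff_mk]
    rcases eq_or_ne j 0 with rfl | h0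
    · simp
    · rw [mem_fil_iff.mp hf j h0 hj, smul_zero]
  change -trace A (PowerSeries.coeff k (eulerDeriv (ser f) * (ser (f⁻¹)))) = 0
  rw [PowerSeries.X_pow_dvd_iff.mp (h.mul_right _) k hkm, map_zero, neg_zero]

theorem logDeriv_binom (m : ℕ) (hm : m ≠ 0) (a : A) {k : ℕ} (hk : k ≠ 0) :
    logDeriv k (Additive.ofMul (binom m hm a)) =
      trace A (if m ∣ k then m • a ^ (k / m) else 0) := by
  -- The geometric series gives D(1 - a t^m) · (1 - a t^m)⁻¹ = -∑_{i ≥ 1} m a^i t^(mi), with D = t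
  -- d/dt. It is checked after multiplying by 1 - a t^m, so no explicit inverse is needed.
  have h : PowerSeries.mk (fun k => if k ≠ 0 ∧ m ∣ k then -(m • a ^ (k / m)) else 0) *
      (ser (binom m hm a)) = eulerDeriv (ser (binom m hm a)) := by
    have hX : PowerSeries.monomial m a = PowerSeries.C a * PowerSeries.X ^ m :=
      PowerSeries.monomial_eq_C_mul_X_pow _ _
    ext j
    rw [ser_binom, mul_sub, mul_one, hX, ← mul_assoc, map_sub, PowerSeries.coeff_mul_X_pow',
      PowerSeries.coeff_mk, eulerDeriv, PowerSeries.coeff_mk, ← hX, map_sub, PowerSeries.coeff_one,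
      PowerSeries.coeff_monomial]
    by_cases hmj : m ≤ j
    · have hj : j ≠ 0 := by omega
      obtain ⟨i, rfl⟩ := Nat.exists_eq_add_of_le hmj
      rw [if_pos hmj, PowerSeries.coeff_mul_C, PowerSeries.coeff_mk, if_neg hj, Nat.add_sub_cancel_left,
        Nat.add_div_left _ (Nat.pos_of_ne_zero hm)]
      by_cases hi : i = 0
      · subst hi
        simp [hm]
      · by_cases hmi : m ∣ i
        · simp [hi, hmi, hm, pow_succ, mul_assoc]
        · simp [hi, hmi, hm]
    · have hjm : j ≠ m := by omega
      have : ¬ (j ≠ 0 ∧ m ∣ j) := fun h => hmj (Nat.le_of_dvd (Nat.pos_of_ne_zero h.1) h.2)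
      rw [if_neg this, if_neg hmj, if_neg hjm]
      split_ifs with h0 <;> simp [h0]
  change -trace A (PowerSeries.coeff k (eulerDeriv (ser (binom m hm a)) * (ser ((binom m hm a)⁻¹)))) = _
  rw [← h, mul_assoc, ser_mul_ser_inv, mul_one, PowerSeries.coeff_mk, ← map_neg]
  congr 1
  split_ifs <;> simp_all

end OneUnits

end LogDeriv

/-! ## The case of the bimodule `R` -/

section Collapse

variable {R : Type u} {S : Type v} [Ring R] [Ring S]

/-- The ring homomorphism `T_R(R) → R` that is the identity in each degree. -/
noncomputable def collapse (R : Type u) [Ring R] : TensorRing R R →+* R :=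
  RingQuot.lift ⟨(FreeAlgebra.lift ℤ (Sum.elim id id)).toRingHom, by
    intro x y h
    cases h <;> simp⟩

@[simp] theorem collapse_scalar (r : R) : collapse R (scalar R R r) = r := by
  refine (RingQuot.lift_mkRingHom_apply _ _ _).trans ?_
  simp

@[simp] theorem collapse_vec (r : R) : collapse R (vec R R r) = r := by
  refine (RingQuot.lift_mkRingHom_apply _ _ _).trans ?_
  simp

theorem vec_eq_scalar_mul (r : R) : vec R R r = scalar R R r * vec R R 1 := by
  rw [← vec_smul, smul_eq_mul, mul_one]

theorem vec_one_mul_scalar (r : R) : vec R R 1 * scalar R R r = scalar R R r * vec R R 1 := by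
  rw [← vec_op_smul, ← vec_smul, smul_eq_mul, mul_one, op_smul_eq_mul, one_mul]

/-- The vector v = `vec R R 1` commutes with scalars and generates all vectors over them, so degree
k consists of the elements r v^k, and `collapse` reads off r. -/
theorem eq_scalar_collapse_mul {k : ℕ} {x : TensorRing R R} (hx : x ∈ tensorPower R R k) :
    x = scalar R R (collapse R x) * vec R R 1 ^ k := by
  have hv : ∀ j : ℕ, ∀ y ∈ AddSubgroup.toIntSubmodule (vec R R).range ^ j,
      y = scalar R R (collapse R y) * vec R R 1 ^ j := by
    intro j
    induction j with
    | zero =>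
      intro y hy
      rw [pow_zero, Submodule.mem_one] at hy
      obtain ⟨z, rfl⟩ := hy
      simp
    | succ j ih =>
      intro y hy
      rw [pow_succ] at hy
      induction hy using Submodule.mul_induction_on' with
      | mem_mul_mem a ha b hb =>
        obtain ⟨m, rfl⟩ := hb
        have hc : Commute (vec R R 1 ^ j) (scalar R R m) :=
          Commute.pow_left (vec_one_mul_scalar m) j
        conv_lhs => rw [ih a ha, vec_eq_scalar_mul m, mul_assoc, ← mul_assoc _ (scalar R R m),
          hc.eq, mul_assoc, ← pow_succ, ← mul_assoc, ← map_mul]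
        rw [map_mul (collapse R), collapse_vec]
      | add a _ b _ ha hb =>
        conv_lhs => rw [ha, hb, ← add_mul, ← map_add, ← map_add]
  rw [tensorPower] at hx
  induction hx using Submodule.mul_induction_on' with
  | mem_mul_mem a ha b hb =>
    obtain ⟨r, rfl⟩ := ha
    have hr : (scalar R R).toAddMonoidHom r = scalar R R r := rfl
    conv_lhs => rw [hv k b hb, hr, ← mul_assoc, ← map_mul]
    rw [hr, map_mul (collapse R), collapse_scalar]
  | add a _ b _ ha hb =>
    conv_lhs => rw [ha, hb, ← add_mul, ← map_add, ← map_add]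

theorem scalar_mul_vec_one_pow_mem (k : ℕ) (r : R) :
    scalar R R r * vec R R 1 ^ k ∈ tensorPower R R k :=
  Submodule.mul_mem_mul ⟨r, rfl⟩ (Submodule.pow_mem_pow _
    (show vec R R 1 ∈ AddSubgroup.toIntSubmodule (vec R R).range from ⟨1, rfl⟩) k)

theorem collapse_tensorMap (φ : R →+* S) {k : ℕ} {x : TensorRing R R}
    (hx : x ∈ tensorPower R R k) :
    collapse S (tensorMap (BimodHom.ofRingHom φ) x) = φ (collapse R x) := by
  rw [eq_scalar_collapse_mul hx]
  have h : (BimodHom.ofRingHom φ).hom 1 = 1 := map_one φ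
  simp only [map_mul, map_pow, tensorMap_scalar, tensorMap_vec, collapse_scalar, collapse_vec, h]
  simp [BimodHom.ofRingHom]

/-- The homomorphism from the special units `Ŝ(R;R)` to `1 + t R⟦t⟧`. -/
noncomputable def collapseUnits (R : Type u) [Ring R] : SpecialUnits R R →* OneUnits R :=
  ((Units.map (PowerSeries.map (collapse R)).toMonoidHom).comp
    (SpecialUnits R R).subtype).codRestrict _ fun f => by
      rw [mem_oneUnits]
      change PowerSeries.constantCoeff (PowerSeries.map (collapse R) f.1) = 1
      rw [← PowerSeries.coeff_zero_eq_constantCoeff_apply, PowerSeries.coeff_map, f.2.1, map_one]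

open OneUnits

theorem coeff_collapseUnits (f : SpecialUnits R R) (k : ℕ) :
    PowerSeries.coeff k (ser (collapseUnits R f)) =
      collapse R (PowerSeries.coeff k (f.1 : (TensorRing R R)⟦X⟧)) :=
  PowerSeries.coeff_map _ _ _

theorem coeff_specialUnits (f : SpecialUnits R R) (k : ℕ) :
    PowerSeries.coeff k (f.1 : (TensorRing R R)⟦X⟧) =
      scalar R R (PowerSeries.coeff k (ser (collapseUnits R f))) * vec R R 1 ^ k := by
  rw [coeff_collapseUnits]
  exact eq_scalar_collapse_mul (f.2.2 k)

theorem collapseUnits_bijective (R : Type u) [Ring R] :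
    Function.Bijective (collapseUnits R) := by
  refine ⟨fun f g h => Subtype.ext (Units.ext (PowerSeries.ext fun k => ?_)), fun g => ?_⟩
  · rw [coeff_specialUnits, coeff_specialUnits, h]
  · let s : (TensorRing R R)⟦X⟧ :=
      PowerSeries.mk fun k => scalar R R (PowerSeries.coeff k (ser g)) * vec R R 1 ^ k
    have h0 : PowerSeries.constantCoeff s = ((1 : (TensorRing R R)ˣ) : TensorRing R R) := by
      rw [← PowerSeries.coeff_zero_eq_constantCoeff_apply, PowerSeries.coeff_mk]
      simp
    refine ⟨⟨⟨s, PowerSeries.invOfUnit s 1, PowerSeries.mul_invOfUnit _ _ h0,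
      PowerSeries.invOfUnit_mul _ _ h0⟩,
      (PowerSeries.coeff_zero_eq_constantCoeff_apply _).trans h0, fun k => ?_⟩, ?_⟩
    · change PowerSeries.coeff k s ∈ _
      rw [PowerSeries.coeff_mk]
      exact scalar_mul_vec_one_pow_mem _ _
    · refine ser_injective (PowerSeries.ext fun k => ?_)
      rw [coeff_collapseUnits]
      change collapse R (PowerSeries.coeff k s) = _
      rw [PowerSeries.coeff_mk]
      simp

/-- The special units `Ŝ(R;R)` are `1 + t R⟦t⟧`. -/
noncomputable def specialUnitsEquiv (R : Type u) [Ring R] : SpecialUnits R R ≃* OneUnits R :=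
  MulEquiv.ofBijective (collapseUnits R) (collapseUnits_bijective R)

theorem specialUnitsEquiv_oneSubTensor (k : ℕ) (hk : k ≠ 0) (m : Fin k → R) :
    specialUnitsEquiv R (oneSubTensor k hk m) = binom k hk (List.ofFn m).prod := by
  refine ser_injective (PowerSeries.ext fun j => ?_)
  refine (coeff_collapseUnits _ j).trans ?_
  change collapse R (PowerSeries.coeff j (1 - PowerSeries.monomial k (elemTensor m))) =
    PowerSeries.coeff j (1 - PowerSeries.monomial k _)
  have h : collapse R (elemTensor m) = (List.ofFn m).prod := by
    simp [elemTensor, map_list_prod, List.map_ofFn, Function.comp_def]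
  rw [map_sub, map_sub, map_sub, PowerSeries.coeff_one, PowerSeries.coeff_one,
    PowerSeries.coeff_monomial, PowerSeries.coeff_monomial, ← h]
  split_ifs <;> simp

theorem specialUnitsEquiv_tau (r : R) :
    specialUnitsEquiv R (tau r) = binom 1 one_ne_zero r := by
  rw [tau, specialUnitsEquiv_oneSubTensor]
  simp

theorem specialUnitsEquiv_unitsMap (φ : R →+* S) (f : SpecialUnits R R) :
    specialUnitsEquiv S (unitsMap (BimodHom.ofRingHom φ) f) =
      OneUnits.map φ (specialUnitsEquiv R f) := by
  refine ser_injective (PowerSeries.ext fun k => ?_)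
  refine (coeff_collapseUnits _ k).trans ?_
  change collapse S (PowerSeries.coeff k (PowerSeries.map (tensorMap (BimodHom.ofRingHom φ))
    (f.1 : (TensorRing R R)⟦X⟧))) = _
  rw [PowerSeries.coeff_map, collapse_tensorMap φ (f.2.2 k), ser_map, PowerSeries.coeff_map]
  exact congrArg φ (coeff_collapseUnits f k).symm

/-- The product `a · 1 ⋯ 1`. -/
theorem prod_ofFn_ite (k : ℕ) (hk : k ≠ 0) (a : R) :
    (List.ofFn fun l : Fin k => if (l : ℕ) = 0 then a else 1).prod = a := by
  obtain ⟨j, rfl⟩ := Nat.exists_eq_succ_of_ne_zero hk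
  rw [List.ofFn_succ, List.prod_cons]
  simp

/-- Membership is a condition on finitely many discrete coefficients. Consequently every subgroup
containing 1 + t^m R⟦t⟧ is open, and so closed. -/
theorem isOpen_comap_fil (m : ℕ) :
    IsOpen (((fil R m).comap (specialUnitsEquiv R).toMonoidHom : Subgroup (SpecialUnits R R)) :
      Set (SpecialUnits R R)) := by
  have h : (((fil R m).comap (specialUnitsEquiv R).toMonoidHom : Subgroup (SpecialUnits R R)) :
      Set (SpecialUnits R R)) = ⋂ k ∈ Finset.range m, {f | k ≠ 0 →
        PowerSeries.coeff k (f.1 : (TensorRing R R)⟦X⟧) = 0} := by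
    ext f
    simp only [Set.mem_iInter, Finset.mem_range]
    change specialUnitsEquiv R f ∈ fil R m ↔ ∀ k, k < m → k ≠ 0 → _
    rw [mem_fil_iff]
    refine forall_congr' fun k => ⟨fun h h1 h2 => ?_, fun h h1 h2 => ?_⟩
    · rw [coeff_specialUnits, show PowerSeries.coeff k (ser (collapseUnits R f)) = 0 from h h2 h1]
      simp
    · refine (coeff_collapseUnits f k).trans ?_
      rw [h h2 h1, map_zero]
  rw [h]
  refine isOpen_biInter_finset fun k _ => ?_
  have hc : Continuous fun f : SpecialUnits R R =>
      PowerSeries.coeff k (f.1 : (TensorRing R R)⟦X⟧) :=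
    (PowerSeries.WithPiTopology.continuous_coeff _ k).comp
      (Units.continuous_val.comp continuous_subtype_val)
  exact (isOpen_discrete {x : TensorRing R R | k ≠ 0 → x = 0}).preimage hc

theorem tendsto_one_of_mem_fil {u : ℕ → SpecialUnits R R}
    (hu : ∀ m, specialUnitsEquiv R (u m) ∈ fil R m) :
    Filter.Tendsto u Filter.atTop (nhds 1) := by
  have key : ∀ w : ℕ → SpecialUnits R R, (∀ m, specialUnitsEquiv R (w m) ∈ fil R m) →
      Filter.Tendsto (fun m => ((w m).1 : (TensorRing R R)⟦X⟧)) Filter.atTop (nhds 1) := by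
    intro w hw
    rw [PowerSeries.WithPiTopology.tendsto_iff_coeff_tendsto]
    intro k
    refine tendsto_nhds_of_eventually_eq ?_
    filter_upwards [Filter.eventually_gt_atTop k] with m hm
    rcases eq_or_ne k 0 with rfl | hk
    · rw [(w m).2.1]
      simp
    · rw [coeff_specialUnits, PowerSeries.coeff_one, if_neg hk,
        show PowerSeries.coeff k (ser (collapseUnits R (w m))) = 0 from
          mem_fil_iff.mp (hw m) k hk hm]
      simp
  -- The topology on units is induced by u ↦ (u, u⁻¹), so the inverses must converge as well. They
  -- lie in the same filtration steps.
  rw [tendsto_subtype_rng, Units.isInducing_embedProduct.tendsto_nhds_iff]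
  rw [nhds_prod_eq]
  refine (key u hu).prodMk ?_
  refine (MulOpposite.continuous_op.tendsto _).comp (key (fun m => (u m)⁻¹) fun m => ?_)
  rw [map_inv]
  exact inv_mem (hu m)

/-- A closed subgroup containing all the `1 - a t^k` with `k ≥ m` contains `1 + t^m R⟦t⟧`. -/
theorem comap_fil_le_of_isClosed {m : ℕ} (hm : m ≠ 0) {K : Subgroup (SpecialUnits R R)}
    (hK : IsClosed (K : Set (SpecialUnits R R)))
    (h : ∀ k (hk : k ≠ 0) (a : R), m ≤ k → (specialUnitsEquiv R).symm (binom k hk a) ∈ K) :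
    (fil R m).comap (specialUnitsEquiv R).toMonoidHom ≤ K := by
  intro f hf
  replace hf : specialUnitsEquiv R f ∈ fil R m := hf
  -- Elements g of K approximate f to order m + j. The next one absorbs the leading term of f g⁻¹
  -- into a binomial of degree m + j, which lies in K by hypothesis. Closedness of K then yields f
  -- as the limit.
  have key : ∀ j, ∃ g ∈ K, specialUnitsEquiv R (f * g⁻¹) ∈ fil R (m + j) := by
    intro j
    induction j with
    | zero => exact ⟨1, one_mem _, by simpa using hf⟩
    | succ j ih =>
      obtain ⟨g, hg, hfg⟩ := ih
      have hmj : m + j ≠ 0 := by omega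
      set b := binom (m + j) hmj (-PowerSeries.coeff (m + j) (ser (specialUnitsEquiv R (f * g⁻¹))))
      refine ⟨(specialUnitsEquiv R).symm b * g, mul_mem (h _ _ _ (by omega)) hg, ?_⟩
      rw [mul_inv_rev, ← mul_assoc, map_mul, map_inv _ ((specialUnitsEquiv R).symm b),
        MulEquiv.apply_symm_apply]
      refine mul_inv_mem_fil_succ hmj hfg (binom_mem_fil _ _ _) ?_
      rw [coeff_binom, neg_neg]
  choose g hg hfg using key
  have ht := tendsto_one_of_mem_fil fun j => fil_anti (Nat.le_add_left j m) (hfg j)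
  have ht2 : Filter.Tendsto g Filter.atTop (nhds f) := by
    have := ht.inv.mul_const f
    simpa using this
  exact hK.mem_of_tendsto ht2 (Filter.Eventually.of_forall hg)

end Collapse

/-! ### The Witt group of the bimodule `R` as an algebraic quotient, without closures -/

section WittClass

variable {R : Type u} {S : Type v} [Ring R] [Ring S] (p n : ℕ)

open OneUnits

/-- The relations presenting `W_{⟨p^n⟩}(R;R)` as a quotient of `1 + t R⟦t⟧`. -/
noncomputable def wittRel (R : Type u) [Ring R] : Set (OneUnits R) :=
  {x | ∃ f g : OneUnits R, x = f * g * f⁻¹ * g⁻¹} ∪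
  {x | ∃ r s : R, x = binom 1 one_ne_zero (r * s) * (binom 1 one_ne_zero (s * r))⁻¹} ∪
  {x | ∃ (k : ℕ) (hk : k ≠ 0) (a : R), (∀ i ≤ n, k ≠ p ^ i) ∧ x = binom k hk a} ∪
  (fil R (p ^ n + 1) : Set (OneUnits R))

/-- The class in `W_{⟨p^n⟩}(R;R)` of an element of `1 + t R⟦t⟧`. -/
noncomputable def wittClass : Additive (OneUnits R) →+ TypicalWitt R R p n :=
  MonoidHom.toAdditive (((QuotientGroup.mk' (truncRel R R p n)).comp
    (QuotientGroup.mk' (bigRel R R))).comp (specialUnitsEquiv R).symm.toMonoidHom)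

theorem mk_eq_wittClass (f : SpecialUnits R R) : TypicalWitt.mk p n f =
    wittClass p n (Additive.ofMul (specialUnitsEquiv R f)) := by
  change _ = Additive.ofMul (QuotientGroup.mk' (truncRel R R p n)
    (QuotientGroup.mk' (bigRel R R) ((specialUnitsEquiv R).symm (specialUnitsEquiv R f))))
  rw [MulEquiv.symm_apply_apply]
  rfl

theorem wittClass_surjective : Function.Surjective (wittClass (R := R) p n) :=
  ((QuotientGroup.mk'_surjective _).comp (QuotientGroup.mk'_surjective _)).comp
    (specialUnitsEquiv R).symm.surjective

theorem map_wittClass (φ : R →+* S) (f : OneUnits R) :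
    TypicalWitt.map p n (BimodHom.ofRingHom φ) (wittClass p n (Additive.ofMul f)) =
      wittClass p n (Additive.ofMul (OneUnits.map φ f)) := by
  obtain ⟨g, rfl⟩ := (specialUnitsEquiv R).surjective f
  rw [← mk_eq_wittClass, ← specialUnitsEquiv_unitsMap, ← mk_eq_wittClass]
  rfl

theorem wittClass_eq_zero_iff_mem_truncRel (f : SpecialUnits R R) :
    wittClass p n (Additive.ofMul (specialUnitsEquiv R f)) = 0 ↔
      f ∈ (truncRel R R p n).comap (QuotientGroup.mk' (bigRel R R)) := by
  rw [← mk_eq_wittClass, Subgroup.mem_comap]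
  exact QuotientGroup.eq_one_iff _

theorem wittClass_eq_zero_of_mem [hp : Fact p.Prime] {f : OneUnits R}
    (hf : f ∈ Subgroup.normalClosure (wittRel p n R)) : wittClass p n (Additive.ofMul f) = 0 := by
  -- K is the kernel of the projection from the special units to the Witt group. It is closed and
  -- contains all binomials of degree above p^n, so it contains the whole tail.
  set K := (truncRel R R p n).comap (QuotientGroup.mk' (bigRel R R)) with hK
  have hcl : IsClosed (K : Set (SpecialUnits R R)) :=
    (Subgroup.isClosed_topologicalClosure _).preimage QuotientGroup.continuous_mk
  have hbig : bigRel R R ≤ K := fun f hf => by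
    rw [hK, Subgroup.mem_comap, show QuotientGroup.mk' (bigRel R R) f = 1 from
      (QuotientGroup.eq_one_iff f).mpr hf]
    exact one_mem _
  have htrunc : ∀ (k : ℕ) (hk : k ≠ 0) (a : R), (∀ i ≤ n, k ≠ p ^ i) →
      (specialUnitsEquiv R).symm (binom k hk a) ∈ K := fun k hk a hkp => by
    refine Subgroup.le_topologicalClosure _ (Subgroup.subset_closure ⟨k, hk,
      fun l => if (l : ℕ) = 0 then a else 1, hkp, ?_⟩)
    congr 1
    rw [MulEquiv.symm_apply_eq, specialUnitsEquiv_oneSubTensor, prod_ofFn_ite k hk]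
  have h : Subgroup.normalClosure (wittRel p n R) ≤ K.comap (specialUnitsEquiv R).symm.toMonoidHom := by
    refine Subgroup.normalClosure_le_normal ?_
    rintro x (((⟨f, g, rfl⟩ | ⟨r, s, rfl⟩) | ⟨k, hk, a, hkp, rfl⟩) | hx)
    · refine hbig (Subgroup.le_topologicalClosure _ (Subgroup.subset_normalClosure (Or.inl
        ⟨(specialUnitsEquiv R).symm f, (specialUnitsEquiv R).symm g, ?_⟩)))
      simp
    · refine hbig (Subgroup.le_topologicalClosure _ (Subgroup.subset_normalClosure (Or.inr
        ⟨r, s, ?_⟩)))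
      refine (specialUnitsEquiv R).injective ?_
      rw [map_mul _ (tau _), map_inv _ (tau _), specialUnitsEquiv_tau, specialUnitsEquiv_tau]
      exact (specialUnitsEquiv R).apply_symm_apply _
    · exact htrunc k hk a hkp
    · refine comap_fil_le_of_isClosed (m := p ^ n + 1) (Nat.succ_ne_zero _) hcl
        (fun k hk a hpk => htrunc k hk a ?_) ?_
      · rintro i hi rfl
        exact absurd (Nat.pow_le_pow_right hp.out.pos hi) (by omega)
      · change specialUnitsEquiv R ((specialUnitsEquiv R).symm x) ∈ fil R (p ^ n + 1)
        rwa [MulEquiv.apply_symm_apply]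
  obtain ⟨g, rfl⟩ := (specialUnitsEquiv R).surjective f
  rw [wittClass_eq_zero_iff_mem_truncRel]
  have := h hf
  rwa [Subgroup.mem_comap, MulEquiv.coe_toMonoidHom, MulEquiv.symm_apply_apply] at this

/-- The normal closure contains the tail 1 + t^(p^n+1) R⟦t⟧, hence is open and closed, so it absorbs
both closures taken in the definition. -/
theorem wittClass_eq_zero_iff [Fact p.Prime] (f : OneUnits R) :
    wittClass p n (Additive.ofMul f) = 0 ↔ f ∈ Subgroup.normalClosure (wittRel p n R) := by
  refine ⟨fun hf => ?_, wittClass_eq_zero_of_mem p n⟩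
  set K := (Subgroup.normalClosure (wittRel p n R)).comap (specialUnitsEquiv R).toMonoidHom with hK
  have hsub : ∀ {x}, specialUnitsEquiv R x ∈ wittRel p n R → x ∈ K :=
    fun h => Subgroup.subset_normalClosure h
  have hop : IsOpen (K : Set (SpecialUnits R R)) :=
    Subgroup.isOpen_mono (fun x hx => hsub (Or.inr hx)) (isOpen_comap_fil (p ^ n + 1))
  have hcl : IsClosed (K : Set (SpecialUnits R R)) := Subgroup.isClosed_of_isOpen K hop
  have hbig : bigRel R R ≤ K := by
    refine Subgroup.topologicalClosure_minimal _ (Subgroup.normalClosure_le_normal ?_) hcl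
    rintro x (⟨f, g, rfl⟩ | ⟨r, s, rfl⟩)
    · exact hsub (Or.inl (Or.inl (Or.inl
        ⟨specialUnitsEquiv R f, specialUnitsEquiv R g, by simp⟩)))
    · exact hsub (Or.inl (Or.inl (Or.inr ⟨r, s, by
        rw [map_mul, map_inv, specialUnitsEquiv_tau, specialUnitsEquiv_tau]; rfl⟩)))
  -- K contains `bigRel R R`, so it is saturated for the quotient map, and closedness of K passes to
  -- its image in the quotient topology.
  have hcomap : (K.map (QuotientGroup.mk' (bigRel R R))).comap (QuotientGroup.mk' (bigRel R R)) =
      K := by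
    rw [Subgroup.comap_map_eq, QuotientGroup.ker_mk', sup_eq_left]
    exact hbig
  have htrunc : truncRel R R p n ≤ K.map (QuotientGroup.mk' (bigRel R R)) := by
    refine Subgroup.topologicalClosure_minimal _ ?_ ?_
    · rw [Subgroup.closure_le]
      rintro _ ⟨k, hk, m, hkp, rfl⟩
      exact ⟨_, hsub (Or.inl (Or.inr ⟨k, hk, _, hkp, specialUnitsEquiv_oneSubTensor k hk m⟩)), rfl⟩
    · refine (QuotientGroup.isQuotientMap_mk (N := bigRel R R)).isClosed_preimage.mp ?_
      change IsClosed (((K.map (QuotientGroup.mk' (bigRel R R))).comap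
        (QuotientGroup.mk' (bigRel R R)) : Subgroup _) : Set (SpecialUnits R R))
      rw [hcomap]
      exact hcl
  obtain ⟨g, rfl⟩ := (specialUnitsEquiv R).surjective f
  have h := Subgroup.comap_mono htrunc ((wittClass_eq_zero_iff_mem_truncRel p n g).mp hf)
  rw [hcomap] at h
  exact h

end WittClass

/-! ## Coordinates and ghost components on `W_{⟨p^n⟩}(R;R)` -/

section Coordinates

open OneUnits

variable (p n : ℕ) [hp : Fact p.Prime] {R : Type u} {S : Type v} [Ring R] [Ring S]

theorem wittClass_binom_mul_comm (k : ℕ) (hk : k ≠ 0) (r s : R) :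
    wittClass p n (Additive.ofMul (binom k hk (r * s))) =
      wittClass p n (Additive.ofMul (binom k hk (s * r))) := by
  refine map_binom_mul_comm (Multiplicative (TypicalWitt R R p n))
    (MonoidHom.mk' (fun f => Multiplicative.ofAdd (wittClass p n (Additive.ofMul f)))
      fun f g => map_add (wittClass p n) (Additive.ofMul f) (Additive.ofMul g)) (fun r s => ?_) k hk r s
  have h : wittClass p n (Additive.ofMul
      (binom 1 one_ne_zero (r * s) * (binom 1 one_ne_zero (s * r))⁻¹)) = 0 :=
    wittClass_eq_zero_of_mem p n (Subgroup.subset_normalClosure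
      (Or.inl (Or.inl (Or.inr ⟨r, s, rfl⟩))))
  rw [ofMul_mul, ofMul_inv, map_add, map_neg, add_neg_eq_zero] at h
  exact h

theorem wittClass_binom_eq_zero {k : ℕ} (hk : k ≠ 0) (hkp : ∀ i ≤ n, k ≠ p ^ i) (a : R) :
    wittClass p n (Additive.ofMul (binom k hk a)) = 0 :=
  wittClass_eq_zero_of_mem p n (Subgroup.subset_normalClosure
    (Or.inl (Or.inr ⟨k, hk, a, hkp, rfl⟩)))

theorem wittClass_eq_zero_of_mem_fil {m : ℕ} (hm : p ^ n < m) {f : OneUnits R}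
    (hf : f ∈ fil R m) : wittClass p n (Additive.ofMul f) = 0 :=
  wittClass_eq_zero_of_mem p n (Subgroup.subset_normalClosure (Or.inr (fil_anti hm hf)))

theorem wittCoord_eq_sum (a : Fin (n + 1) → R) : wittCoord p n a =
    ∑ i : Fin (n + 1), wittClass p n (Additive.ofMul
      (binom (p ^ (i : ℕ)) (pow_ne_zero _ hp.out.ne_zero) (a i))) := by
  refine Finset.sum_congr rfl fun i _ => ?_
  rw [mk_eq_wittClass, specialUnitsEquiv_oneSubTensor,
    prod_ofFn_ite _ (pow_ne_zero _ hp.out.ne_zero)]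

theorem wittCoord_zero : wittCoord p n (0 : Fin (n + 1) → R) = 0 := by
  rw [wittCoord_eq_sum]
  exact Finset.sum_eq_zero fun i _ => by simp

theorem map_wittCoord (φ : R →+* S) (a : Fin (n + 1) → R) :
    TypicalWitt.map p n (BimodHom.ofRingHom φ) (wittCoord p n a) =
      wittCoord p n fun i => φ (a i) := by
  rw [wittCoord_eq_sum, wittCoord_eq_sum, map_sum]
  exact Finset.sum_congr rfl fun i _ => by rw [map_wittClass, map_binom]

theorem wittCoord_update {a : Fin (n + 1) → R} {i : Fin (n + 1)} (hi : a i = 0) (r : R) :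
    wittCoord p n (Function.update a i r) = wittCoord p n a + wittClass p n
      (Additive.ofMul (binom (p ^ (i : ℕ)) (pow_ne_zero _ hp.out.ne_zero) r)) := by
  rw [wittCoord_eq_sum, wittCoord_eq_sum, ← Finset.add_sum_erase _ _ (Finset.mem_univ i),
    ← Finset.add_sum_erase _ (fun j : Fin (n + 1) => wittClass p n (Additive.ofMul
      (binom (p ^ (j : ℕ)) (pow_ne_zero _ hp.out.ne_zero) (a j)))) (Finset.mem_univ i), hi,
    Function.update_self, binom_zero, ofMul_one, map_zero, zero_add, add_comm]
  congr 1
  refine Finset.sum_congr rfl fun j hj => ?_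
  rw [Function.update_of_ne (Finset.ne_of_mem_erase hj)]

/-- The class of a series in `1 + t I⟦t⟧`, with `I` the kernel of `φ`, has coordinates in `I`. -/
theorem exists_wittCoord_of_map_eq_one (φ : R →+* S) {f : OneUnits R}
    (hf : OneUnits.map φ f = 1) :
    ∃ a : Fin (n + 1) → R, (∀ i, φ (a i) = 0) ∧
      wittClass p n (Additive.ofMul f) = wittCoord p n a := by
  -- The number d bounds the degrees left before p^n is exceeded, after which the class vanishes.
  -- The vanishing of the coordinates with p^i < m leaves slot i empty when the leading term of
  -- degree m = p^i is inserted.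
  have key : ∀ d m (f : OneUnits R), m ≠ 0 → p ^ n < m + d → f ∈ fil R m →
      OneUnits.map φ f = 1 → ∃ a : Fin (n + 1) → R, (∀ i, φ (a i) = 0) ∧
        (∀ i : Fin (n + 1), p ^ (i : ℕ) < m → a i = 0) ∧
        wittClass p n (Additive.ofMul f) = wittCoord p n a := by
    intro d
    induction d with
    | zero =>
      intro m f hm hd hfm hf
      refine ⟨0, fun i => map_zero φ, fun i _ => rfl, ?_⟩
      rw [wittCoord_zero, wittClass_eq_zero_of_mem_fil p n hd hfm]
    | succ d ih =>
      intro m f hm hd hfm hf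
      set r := -PowerSeries.coeff m (ser f) with hr
      have hφr : φ r = 0 := by
        have h := congrArg (fun g => PowerSeries.coeff m (ser g)) hf
        simp only [ser_map, PowerSeries.coeff_map, ser_one, PowerSeries.coeff_one, if_neg hm] at h
        rw [hr, map_neg, h, neg_zero]
      obtain ⟨b, hb1, hb2, hb3⟩ := ih (m + 1) (f * (binom m hm r)⁻¹) (Nat.succ_ne_zero m)
        (by omega) (mul_inv_mem_fil_succ hm hfm (binom_mem_fil _ _ _)
          (by rw [coeff_binom, hr, neg_neg]))
        (by rw [map_mul, map_inv, hf, map_binom, hφr, binom_zero, inv_one, mul_one])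
      rw [ofMul_mul, ofMul_inv, map_add, map_neg, add_neg_eq_iff_eq_add] at hb3
      by_cases hmp : ∀ i ≤ n, m ≠ p ^ i
      · refine ⟨b, hb1, fun i hi => hb2 i (by omega), ?_⟩
        rw [hb3, wittClass_binom_eq_zero p n hm hmp, add_zero]
      · push Not at hmp
        obtain ⟨i, hi, rfl⟩ := hmp
        let i' : Fin (n + 1) := ⟨i, Nat.lt_succ_of_le hi⟩
        refine ⟨Function.update b i' r, fun j => ?_, fun j hj => ?_, ?_⟩
        · rcases eq_or_ne j i' with rfl | hj
          · rw [Function.update_self, hφr]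
          · rw [Function.update_of_ne hj, hb1]
        · rw [Function.update_of_ne, hb2 j (by omega)]
          rintro rfl
          exact lt_irrefl _ hj
        · rw [wittCoord_update p n (hb2 i' (Nat.lt_succ_self _)), hb3]
  obtain ⟨a, ha, -, h⟩ := key (p ^ n) 1 f one_ne_zero (by omega) (mem_fil_one f) hf
  exact ⟨a, ha, h⟩

/-- This is the case of the map to the zero ring: every series becomes 1 there, and the condition on
the coordinates is empty. -/
theorem wittCoord_surjective : Function.Surjective (wittCoord p n (R := R)) := by
  intro x
  obtain ⟨f, rfl⟩ := wittClass_surjective p n x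
  obtain ⟨a, -, ha⟩ := exists_wittCoord_of_map_eq_one p n
    (RingHom.mk' (1 : R →* PUnit.{u + 1}) fun _ _ => rfl) (f := f.toMul)
    (ser_injective (PowerSeries.ext fun _ => rfl))
  exact ⟨a, ha.symm⟩

theorem map_surjective_of_surjective {φ : R →+* S} (hφ : Function.Surjective φ) :
    Function.Surjective (TypicalWitt.map p n (BimodHom.ofRingHom φ)) := by
  intro y
  obtain ⟨b, rfl⟩ := wittCoord_surjective p n y
  choose s hs using hφ
  exact ⟨wittCoord p n fun i => s (b i), by simp [map_wittCoord, hs]⟩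

/-- Every relation over S lifts to a relation over R. A series whose class dies in S can therefore
be corrected by a relation over R to map to 1, and then has coordinates in the kernel of φ. -/
theorem map_eq_zero_iff {φ : R →+* S} (hφ : Function.Surjective φ) (x : TypicalWitt R R p n) :
    TypicalWitt.map p n (BimodHom.ofRingHom φ) x = 0 ↔
      ∃ a : Fin (n + 1) → R, (∀ i, φ (a i) = 0) ∧ x = wittCoord p n a := by
  constructor
  · intro hx
    obtain ⟨f, rfl⟩ := wittClass_surjective p n x
    replace hx : wittClass p n (Additive.ofMul (OneUnits.map φ f.toMul)) = 0 :=
      (map_wittClass p n φ f.toMul).symm.trans hx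
    have hle : Subgroup.normalClosure (wittRel p n S) ≤
        (Subgroup.normalClosure (wittRel p n R)).map (OneUnits.map φ) := by
      have : ((Subgroup.normalClosure (wittRel p n R)).map (OneUnits.map φ)).Normal :=
        Subgroup.Normal.map inferInstance _ (OneUnits.map_surjective hφ)
      refine Subgroup.normalClosure_le_normal ?_
      rintro x (((⟨f, g, rfl⟩ | ⟨r, s, rfl⟩) | ⟨k, hk, a, hkp, rfl⟩) | hx)
      · obtain ⟨f, rfl⟩ := OneUnits.map_surjective hφ f
        obtain ⟨g, rfl⟩ := OneUnits.map_surjective hφ g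
        exact ⟨_, Subgroup.subset_normalClosure (Or.inl (Or.inl (Or.inl ⟨f, g, rfl⟩))), by simp⟩
      · obtain ⟨r, rfl⟩ := hφ r
        obtain ⟨s, rfl⟩ := hφ s
        exact ⟨_, Subgroup.subset_normalClosure (Or.inl (Or.inl (Or.inr ⟨r, s, rfl⟩))),
          by simp [map_binom]⟩
      · obtain ⟨a, rfl⟩ := hφ a
        exact ⟨_, Subgroup.subset_normalClosure (Or.inl (Or.inr ⟨k, hk, a, hkp, rfl⟩)),
          by simp [map_binom]⟩
      · obtain ⟨f, hf, rfl⟩ := exists_mem_fil_map_eq hφ hx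
        exact ⟨f, Subgroup.subset_normalClosure (Or.inr hf), rfl⟩
    obtain ⟨g, hg, hgf⟩ := hle ((wittClass_eq_zero_iff p n _).mp hx)
    obtain ⟨a, ha, h⟩ := exists_wittCoord_of_map_eq_one p n φ (f := f.toMul * g⁻¹)
      (by rw [map_mul, map_inv, hgf, mul_inv_cancel])
    refine ⟨a, ha, ?_⟩
    rw [← h, ofMul_mul, ofMul_inv, map_add, map_neg, wittClass_eq_zero_of_mem p n hg, neg_zero,
      add_zero, ofMul_toMul]
  · rintro ⟨a, ha, rfl⟩
    rw [map_wittCoord, ← wittCoord_zero]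
    exact congrArg _ (funext ha)

/-- The ghost components on `1 + t R⟦t⟧`. -/
noncomputable def seriesGhost (R : Type u) [Ring R] :
    Additive (OneUnits R) →+ (Fin (n + 1) → R ⧸ commutators R) :=
  AddMonoidHom.pi fun j => logDeriv (p ^ (j : ℕ))

omit hp in
theorem seriesGhost_apply (f : Additive (OneUnits R)) (j : Fin (n + 1)) :
    seriesGhost p n R f j = logDeriv (p ^ (j : ℕ)) f := rfl

theorem logDeriv_binom_pow {i : ℕ} (j : ℕ) (a : R) :
    logDeriv (p ^ j) (Additive.ofMul (binom (p ^ i) (pow_ne_zero _ hp.out.ne_zero) a)) =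
      if i ≤ j then trace R ((p : R) ^ i * a ^ p ^ (j - i)) else 0 := by
  rw [logDeriv_binom _ _ _ (pow_ne_zero _ hp.out.ne_zero)]
  by_cases h : i ≤ j
  · rw [if_pos h, if_pos (pow_dvd_pow p h), Nat.pow_div h hp.out.pos, nsmul_eq_mul, Nat.cast_pow]
  · rw [if_neg h, if_neg ((Nat.pow_dvd_pow_iff_le_right hp.out.one_lt).not.mpr h), map_zero]

/-- The ghost components kill each type of relation: the target is abelian, traces are cyclic, a k
outside {1, p, …, p^n} divides no p^j with j ≤ n, and the tail starts above degree p^n. -/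
theorem ker_wittClass_le : (wittClass (R := R) p n).ker ≤ (seriesGhost p n R).ker := by
  intro f hf
  let g : OneUnits R →* Multiplicative (Fin (n + 1) → R ⧸ commutators R) :=
    MonoidHom.mk' (fun f => Multiplicative.ofAdd (seriesGhost p n R (Additive.ofMul f)))
      fun f g => map_add (seriesGhost p n R) (Additive.ofMul f) (Additive.ofMul g)
  have key : Subgroup.normalClosure (wittRel p n R) ≤ g.ker := by
    refine Subgroup.normalClosure_le_normal ?_
    rintro x hx
    change seriesGhost p n R (Additive.ofMul x) = 0
    obtain (((⟨f, g, rfl⟩ | ⟨r, s, rfl⟩) | ⟨k, hk, a, hkp, rfl⟩) | hx) := hx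
    · simp only [ofMul_mul, ofMul_inv, map_add, map_neg]
      abel
    · rw [ofMul_mul, ofMul_inv, map_add, map_neg, add_neg_eq_zero]
      funext j
      have hp0 : p ^ (j : ℕ) ≠ 0 := pow_ne_zero _ hp.out.ne_zero
      obtain ⟨q, hq⟩ := Nat.exists_eq_succ_of_ne_zero hp0
      simp only [seriesGhost_apply, logDeriv_binom _ _ _ hp0, one_dvd, if_true, one_smul,
        Nat.div_one]
      rw [hq, pow_succ (s * r), pow_succ' (r * s), mul_assoc, trace_mul_comm r]
      congr 1
      rw [← mul_assoc ((s * r) ^ q), mul_pow_mul]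
    · funext j
      rw [seriesGhost_apply, logDeriv_binom _ _ _ (pow_ne_zero _ hp.out.ne_zero), if_neg, map_zero]
      · rfl
      · intro hd
        obtain ⟨i, hi, rfl⟩ := (Nat.dvd_prime_pow hp.out).mp hd
        exact hkp i (hi.trans (Nat.le_of_lt_succ j.2)) rfl
    · funext j
      exact logDeriv_of_mem_fil (Nat.lt_succ_of_le
        (Nat.pow_le_pow_right hp.out.pos (Nat.le_of_lt_succ j.2))) hx
  exact key ((wittClass_eq_zero_iff p n f.toMul).mp hf)

/-- The ghost map on `W_{⟨p^n⟩}(R;R)`. -/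
noncomputable def wittGhost (R : Type u) [Ring R] :
    TypicalWitt R R p n →+ (Fin (n + 1) → R ⧸ commutators R) :=
  (wittClass p n).liftOfSurjective (wittClass_surjective p n)
    ⟨seriesGhost p n R, ker_wittClass_le p n⟩

theorem wittGhost_wittClass (f : Additive (OneUnits R)) :
    wittGhost p n R (wittClass p n f) = seriesGhost p n R f :=
  AddMonoidHom.liftOfRightInverse_comp_apply _ _ _ _ f

theorem wittGhost_wittCoord (a : Fin (n + 1) → R) :
    wittGhost p n R (wittCoord p n a) = ghost p (n + 1) R a := by
  funext j
  rw [wittCoord_eq_sum, map_sum, Finset.sum_apply]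
  simp only [wittGhost_wittClass, seriesGhost_apply, logDeriv_binom_pow]
  change _ = trace R (wittPoly p a j)
  rw [wittPoly, map_sum, ← Finset.sum_filter]
  refine Finset.sum_congr ?_ fun i _ => rfl
  ext i
  simp

/-- The ghost map is injective if `R/[R,R]` has no `p`-torsion. -/
theorem wittGhost_injective
    (hR : ∀ r : R, (p : R) * r ∈ commutators R → r ∈ commutators R) :
    Function.Injective (wittGhost p n R) := by
  have hpow : ∀ (i : ℕ) (r : R), (p : R) ^ i * r ∈ commutators R → r ∈ commutators R := by
    intro i
    induction i with
    | zero => simp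
    | succ i ih =>
      intro r hr
      rw [pow_succ', mul_assoc] at hr
      exact ih r (hR _ hr)
  -- A commutator xy - yx is the leading coefficient of (1 - yx t^m)(1 - xy t^m)⁻¹, which has
  -- trivial class. Products and inverses give all sums of commutators.
  have hcomm : ∀ (m : ℕ) (hm : m ≠ 0) (r : R), r ∈ commutators R → ∃ f ∈ fil R m,
      wittClass p n (Additive.ofMul f) = 0 ∧ PowerSeries.coeff m (ser f) = r := by
    intro m hm r hr
    induction hr using AddSubgroup.closure_induction with
    | mem z hz =>
      obtain ⟨x, y, rfl⟩ := hz
      refine ⟨binom m hm (y * x) * (binom m hm (x * y))⁻¹,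
        mul_mem (binom_mem_fil _ _ _) (inv_mem (binom_mem_fil _ _ _)), ?_, ?_⟩
      · rw [ofMul_mul, ofMul_inv, map_add, map_neg, wittClass_binom_mul_comm, add_neg_cancel]
      · rw [coeff_mul_of_mem_fil hm (binom_mem_fil _ _ _) (inv_mem (binom_mem_fil _ _ _)),
          coeff_inv_of_mem_fil hm (binom_mem_fil _ _ _), coeff_binom, coeff_binom]
        abel
    | zero => exact ⟨1, one_mem _, by simp, by simp [PowerSeries.coeff_one, hm]⟩
    | add x y _ _ hx hy =>
      obtain ⟨f, hf, hf0, rfl⟩ := hx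
      obtain ⟨g, hg, hg0, rfl⟩ := hy
      exact ⟨f * g, mul_mem hf hg, by rw [ofMul_mul, map_add, hf0, hg0, add_zero],
        coeff_mul_of_mem_fil hm hf hg⟩
    | neg x _ hx =>
      obtain ⟨f, hf, hf0, rfl⟩ := hx
      exact ⟨f⁻¹, inv_mem hf, by rw [ofMul_inv, map_neg, hf0, neg_zero],
        coeff_inv_of_mem_fil hm hf⟩
  -- The leading term of f is removed by a series h of trivial class: a binomial if m is not among
  -- 1, p, …, p^n, and a series from `hcomm` if m = p^i.
  have key : ∀ d m (f : OneUnits R), m ≠ 0 → p ^ n < m + d → f ∈ fil R m →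
      seriesGhost p n R (Additive.ofMul f) = 0 → wittClass p n (Additive.ofMul f) = 0 := by
    intro d
    induction d with
    | zero => exact fun m f hm hd hfm _ => wittClass_eq_zero_of_mem_fil p n hd hfm
    | succ d ih =>
      intro m f hm hd hfm hf
      obtain ⟨h, hh, hh0, hhc⟩ : ∃ h ∈ fil R m, wittClass p n (Additive.ofMul h) = 0 ∧
          PowerSeries.coeff m (ser h) = PowerSeries.coeff m (ser f) := by
        by_cases hmp : ∀ i ≤ n, m ≠ p ^ i
        · exact ⟨binom m hm (-PowerSeries.coeff m (ser f)), binom_mem_fil _ _ _,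
            wittClass_binom_eq_zero p n hm hmp _, by rw [coeff_binom, neg_neg]⟩
        · push Not at hmp
          obtain ⟨i, hi, rfl⟩ := hmp
          refine hcomm _ hm _ ?_
          rw [← neg_mem_iff]
          set r := -PowerSeries.coeff (p ^ i) (ser f) with hr
          -- The quotient has order above p^i, so its ghost component at p^i vanishes. That of f
          -- vanishes too, so the component of the binomial, the trace of p^i r, is zero, and
          -- torsion-freeness puts r in [R,R].
          have h1 : f * (binom (p ^ i) hm r)⁻¹ ∈ fil R (p ^ i + 1) :=
            mul_inv_mem_fil_succ hm hfm (binom_mem_fil _ _ _) (by rw [coeff_binom, hr, neg_neg])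
          have h2 := logDeriv_of_mem_fil (Nat.lt_succ_self _) h1
          have h3 : logDeriv (p ^ i) (Additive.ofMul f) = 0 :=
            congrFun hf ⟨i, Nat.lt_succ_of_le hi⟩
          rw [ofMul_mul, ofMul_inv, map_add, map_neg, h3, zero_add, neg_eq_zero,
            logDeriv_binom_pow, if_pos le_rfl, Nat.sub_self, pow_zero, pow_one, trace_eq_zero] at h2
          exact hpow i r h2
      have hgh : seriesGhost p n R (Additive.ofMul h) = 0 := ker_wittClass_le p n hh0
      have := ih (m + 1) (f * h⁻¹) (Nat.succ_ne_zero m) (by omega)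
        (mul_inv_mem_fil_succ hm hfm hh hhc.symm)
        (by rw [ofMul_mul, ofMul_inv, map_add, map_neg, hf, hgh, neg_zero, add_zero])
      rwa [ofMul_mul, ofMul_inv, map_add, map_neg, hh0, neg_zero, add_zero] at this
  rw [injective_iff_map_eq_zero]
  intro x hx
  obtain ⟨f, rfl⟩ := wittClass_surjective p n x
  rw [wittGhost_wittClass] at hx
  exact key (p ^ n) 1 f.toMul one_ne_zero (by omega) (mem_fil_one _) hx

end Coordinates

/-! ## Free rings modulo commutators -/

section FreeRing

variable {X : Type u}

/-- Two words are related if they are cyclic rotations of one another. -/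
def Rotation (u v : FreeMonoid X) : Prop := ∃ a b, u = a * b ∧ v = b * a

/-- The additive map sending a word to its cyclic word. -/
noncomputable def cyclicWord (X : Type u) :
    MonoidAlgebra ℤ (FreeMonoid X) →+ (Quot (Rotation (X := X)) →₀ ℤ) :=
  (Finsupp.mapDomain.addMonoidHom (Quot.mk Rotation)).comp
    MonoidAlgebra.coeffAddEquiv.toAddMonoidHom

theorem cyclicWord_single (w : FreeMonoid X) (z : ℤ) :
    cyclicWord X (MonoidAlgebra.single w z) = Finsupp.single (Quot.mk Rotation w) z :=
  Finsupp.mapDomain_single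

theorem cyclicWord_mul_comm (x y : MonoidAlgebra ℤ (FreeMonoid X)) :
    cyclicWord X (x * y) = cyclicWord X (y * x) := by
  induction x using MonoidAlgebra.induction_linear with
  | zero => simp
  | add x x' hx hx' => rw [add_mul, mul_add, map_add, map_add, hx, hx']
  | single v z =>
    induction y using MonoidAlgebra.induction_linear with
    | zero => simp
    | add y y' hy hy' => rw [add_mul, mul_add, map_add, map_add, hy, hy']
    | single w z' =>
      rw [MonoidAlgebra.single_mul_single, MonoidAlgebra.single_mul_single, cyclicWord_single,
        cyclicWord_single, mul_comm z]
      congr 1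
      exact Quot.sound ⟨v, w, rfl, rfl⟩

/-- A rotation ab ↦ ba does not change the trace of a word. Hence the trace factors through the free
abelian group on cyclic words, and an element with zero cyclic word is a sum of commutators. -/
theorem exists_trace_eq_cyclicWord (X : Type u) :
    ∃ s : (Quot (Rotation (X := X)) →₀ ℤ) →+
        MonoidAlgebra ℤ (FreeMonoid X) ⧸ commutators (MonoidAlgebra ℤ (FreeMonoid X)),
      ∀ x, trace _ x = s (cyclicWord X x) := by
  let t : Quot (Rotation (X := X)) →
      MonoidAlgebra ℤ (FreeMonoid X) ⧸ commutators (MonoidAlgebra ℤ (FreeMonoid X)) :=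
    Quot.lift (fun w => trace _ (MonoidAlgebra.single w 1)) (by
      rintro _ _ ⟨a, b, rfl, rfl⟩
      have := trace_mul_comm (MonoidAlgebra.single a (1 : ℤ)) (MonoidAlgebra.single b 1)
      simpa [MonoidAlgebra.single_mul_single] using this)
  let s := Finsupp.liftAddHom fun c => (zmultiplesHom _ (t c))
  refine ⟨s, fun x => ?_⟩
  refine DFunLike.congr_fun (f := trace _) (g := s.comp (cyclicWord X)) ?_ x
  refine MonoidAlgebra.addMonoidHom_ext fun w z => ?_
  rw [AddMonoidHom.comp_apply, cyclicWord_single, Finsupp.liftAddHom_apply_single]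
  change _ = z • trace _ (MonoidAlgebra.single w 1)
  rw [← map_zsmul]
  simp

/-- Cyclic words detect membership in the commutator subgroup and take values in a free abelian
group, where division by p ≠ 0 is harmless. -/
theorem mem_commutators_of_mul_mem_freeAlgebra {p : ℕ} (hp : p ≠ 0) (x : FreeAlgebra ℤ X)
    (hx : (p : FreeAlgebra ℤ X) * x ∈ commutators (FreeAlgebra ℤ X)) :
    x ∈ commutators (FreeAlgebra ℤ X) := by
  let e : FreeAlgebra ℤ X ≃+* MonoidAlgebra ℤ (FreeMonoid X) :=
    FreeAlgebra.equivMonoidAlgebraFreeMonoid.toRingEquiv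
  have hle : commutators (FreeAlgebra ℤ X) ≤
      ((cyclicWord X).comp (e : FreeAlgebra ℤ X →+* _).toAddMonoidHom).ker := by
    rw [commutators, AddSubgroup.closure_le]
    rintro _ ⟨a, b, rfl⟩
    change cyclicWord X (e (a * b - b * a)) = 0
    rw [map_sub, map_sub, map_mul e, map_mul e, cyclicWord_mul_comm, sub_self]
  have h1 : cyclicWord X (e (p * x)) = 0 := hle hx
  rw [← nsmul_eq_mul, map_nsmul, map_nsmul] at h1
  have h2 : cyclicWord X (e x) = 0 := (smul_eq_zero.mp h1).resolve_left hp
  obtain ⟨s, hs⟩ := exists_trace_eq_cyclicWord X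
  have h3 : e x ∈ commutators _ := trace_eq_zero.mp (by rw [hs, h2, map_zero])
  have h4 := commutators_le (e.symm : MonoidAlgebra ℤ (FreeMonoid X) →+* FreeAlgebra ℤ X) h3
  change e.symm (e x) ∈ commutators (FreeAlgebra ℤ X) at h4
  rwa [e.symm_apply_apply] at h4

end FreeRing

/-- Used for both comparisons: each pair of groups is presented as two quotients of the Witt group
of a free or polynomial ring on the set `R`. -/
theorem exists_addEquiv_of_ker_eq {G H K : Type*} [AddCommGroup G] [AddCommGroup H]
    [AddCommGroup K] (f : G →+ H) (g : G →+ K) (hf : Function.Surjective f)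
    (hg : Function.Surjective g) (h : ∀ x, f x = 0 ↔ g x = 0) :
    ∃ e : H ≃+ K, ∀ x, e (f x) = g x := by
  let φ := f.liftOfSurjective hf ⟨g, fun x hx => (h x).mp hx⟩
  have hφ : ∀ x, φ (f x) = g x := AddMonoidHom.liftOfRightInverse_comp_apply _ _ _ _
  refine ⟨AddEquiv.ofBijective φ ⟨?_, fun k => ?_⟩, hφ⟩
  · rw [injective_iff_map_eq_zero]
    intro y hy
    obtain ⟨x, rfl⟩ := hf y
    exact (h x).mpr ((hφ x).symm.trans hy)
  · obtain ⟨x, rfl⟩ := hg k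
    exact ⟨f x, hφ x⟩

/-! ## Comparison with Hesselholt's Witt vectors -/

section Hesselholt

variable (p n : ℕ) {R : Type u} {S : Type v} [Ring R] [Ring S]

/-- The projection from the Witt vectors of the free ring. -/
noncomputable def hesselholtMk (R : Type u) [Ring R] :
    ghostImage p n (FreeAlgebra ℤ R) →+ HesselholtWitt p n R :=
  QuotientAddGroup.mk' (presentationRel p n R)

theorem hesselholtMk_surjective (R : Type u) [Ring R] :
    Function.Surjective (hesselholtMk p n R) :=
  QuotientAddGroup.mk'_surjective _

theorem hesselholtMk_eq_zero {x : ghostImage p n (FreeAlgebra ℤ R)} :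
    hesselholtMk p n R x = 0 ↔ x ∈ presentationRel p n R :=
  QuotientAddGroup.eq_zero_iff x

/-- The class in Hesselholt's Witt vectors of a sequence over the free ring. -/
noncomputable def hesselholtClass (R : Type u) [Ring R] (a : Fin n → FreeAlgebra ℤ R) :
    HesselholtWitt p n R :=
  hesselholtMk p n R ⟨ghost p n _ a, AddSubgroup.subset_closure ⟨a, rfl⟩⟩

theorem map_hesselholtClass (f : R →+* S) (a : Fin n → FreeAlgebra ℤ R) :
    HesselholtWitt.map p n f (hesselholtClass p n R a) =
      hesselholtClass p n S fun i => freeMap f (a i) := by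
  exact congrArg (hesselholtMk p n S) (Subtype.ext (ghostTargetMap_ghost p n (freeMap f) a))

theorem counit_surjective (R : Type u) [Ring R] : Function.Surjective (counit R) := fun r =>
  ⟨FreeAlgebra.ι ℤ r, by simp [counit]⟩

variable [hp : Fact p.Prime]

theorem wittGhost_mem (A : Type u) [Ring A] (x : TypicalWitt A A p n) :
    wittGhost p n A x ∈ ghostImage p (n + 1) A := by
  obtain ⟨a, rfl⟩ := wittCoord_surjective p n x
  rw [wittGhost_wittCoord]
  exact AddSubgroup.subset_closure ⟨a, rfl⟩

/-- Over ℤ{R} the ghost map identifies the Witt group with `ghostImage`. What remains is that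
reduction to R has the same kernel on both sides. The formula on coordinates determines e and later
gives its naturality. -/
theorem exists_addEquiv_hesselholtWitt (R : Type u) [Ring R] :
    ∃ e : TypicalWitt R R p n ≃+ HesselholtWitt p (n + 1) R,
      ∀ a : Fin (n + 1) → FreeAlgebra ℤ R,
        e (wittCoord p n fun i => counit R (a i)) = hesselholtClass p (n + 1) R a := by
  have hinj := wittGhost_injective p n
    (mem_commutators_of_mul_mem_freeAlgebra (X := R) hp.out.ne_zero)
  let γ : TypicalWitt (FreeAlgebra ℤ R) (FreeAlgebra ℤ R) p n →+
      ghostImage p (n + 1) (FreeAlgebra ℤ R) :=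
    (wittGhost p n (FreeAlgebra ℤ R)).codRestrict _ (wittGhost_mem p n _)
  have hγ : ∀ a, γ (wittCoord p n a) =
      ⟨ghost p (n + 1) _ a, AddSubgroup.subset_closure ⟨a, rfl⟩⟩ := fun a =>
    Subtype.ext (wittGhost_wittCoord p n a)
  have hγs : Function.Surjective γ := by
    rintro ⟨y, hy⟩
    have : ghostImage p (n + 1) (FreeAlgebra ℤ R) ≤ (wittGhost p n (FreeAlgebra ℤ R)).range := by
      rw [ghostImage, AddSubgroup.closure_le]
      rintro _ ⟨a, rfl⟩
      exact ⟨_, wittGhost_wittCoord p n a⟩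
    obtain ⟨x, rfl⟩ := this hy
    exact ⟨x, rfl⟩
  have hγi : Function.Injective γ := fun x y h => hinj (congrArg Subtype.val h)
  have hker : ∀ x, TypicalWitt.map p n (BimodHom.ofRingHom (counit R)) x = 0 ↔
      (hesselholtMk p (n + 1) R).comp γ x = 0 := by
    intro x
    rw [AddMonoidHom.comp_apply, hesselholtMk_eq_zero]
    constructor
    · rw [map_eq_zero_iff p n (counit_surjective R)]
      rintro ⟨a, ha, rfl⟩
      -- Coordinates in the kernel of the counit form a sequence agreeing over R with the zero
      -- sequence, whose ghost vector is 0.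
      refine AddSubgroup.subset_closure ⟨a, 0, fun i => by simp [ha], ?_⟩
      rw [← wittGhost_wittCoord, ← wittGhost_wittCoord, wittCoord_zero, map_zero, sub_zero]
      rfl
    · intro hx
      have hle : presentationRel p (n + 1) R ≤
          ((TypicalWitt.map p n (BimodHom.ofRingHom (counit R))).ker).map γ := by
        rw [presentationRel, AddSubgroup.closure_le]
        rintro d ⟨a, b, hab, hd⟩
        refine ⟨wittCoord p n a - wittCoord p n b, ?_, Subtype.ext ?_⟩
        · change TypicalWitt.map p n _ _ = 0
          rw [map_sub, map_wittCoord, map_wittCoord, funext hab, sub_self]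
        · rw [hd, map_sub, hγ, hγ]
          rfl
      obtain ⟨y, hy, hyx⟩ := hle hx
      rw [← hγi hyx]
      exact hy
  obtain ⟨e, he⟩ := exists_addEquiv_of_ker_eq
    (TypicalWitt.map p n (BimodHom.ofRingHom (counit R)))
    ((hesselholtMk p (n + 1) R).comp γ)
    (map_surjective_of_surjective p n (counit_surjective R))
    ((hesselholtMk_surjective p (n + 1) R).comp hγs) hker
  refine ⟨e, fun a => ?_⟩
  rw [← map_wittCoord, he]
  exact congrArg (hesselholtMk p (n + 1) R) (hγ a)

end Hesselholt

/-! ## The product for commutative rings -/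

section Product

variable (p n : ℕ) [hp : Fact p.Prime] {R : Type u} {S : Type v} [CommRing R] [CommRing S]

theorem commutators_eq_bot (R : Type u) [CommRing R] : commutators R = ⊥ := by
  rw [commutators, AddSubgroup.closure_eq_bot_iff]
  rintro _ ⟨x, y, rfl⟩
  simp [mul_comm]

theorem trace_injective (R : Type u) [CommRing R] : Function.Injective (trace R) := by
  rw [injective_iff_map_eq_zero]
  intro x hx
  rwa [trace_eq_zero, commutators_eq_bot] at hx

omit hp in
theorem ghost_eq_iff {m : ℕ} (a b : Fin m → R) :
    ghost p m R a = ghost p m R b ↔ ∀ j, wittPoly p a j = wittPoly p b j :=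
  ⟨fun h j => trace_injective R (congrFun h j), fun h => funext fun j => congrArg (trace R) (h j)⟩

omit hp in
theorem ghost_add_eq_iff {m : ℕ} (a b c : Fin m → R) :
    ghost p m R a + ghost p m R b = ghost p m R c ↔
      ∀ j, wittPoly p a j + wittPoly p b j = wittPoly p c j :=
  ⟨fun h j => trace_injective R ((map_add (trace R) _ _).trans (congrFun h j)),
    fun h => funext fun j => (map_add (trace R) _ _).symm.trans (congrArg (trace R) (h j))⟩

omit hp in
/-- The coordinates determine the Witt polynomials if `R` has no `p`-torsion. -/
theorem wittPoly_injective (hR : ∀ r : R, (p : R) * r = 0 → r = 0) {m : ℕ} {a b : Fin m → R}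
    (h : ∀ j, wittPoly p a j = wittPoly p b j) : a = b := by
  have hpow : ∀ (i : ℕ) (r : R), (p : R) ^ i * r = 0 → r = 0 := by
    intro i
    induction i with
    | zero => simp
    | succ i ih =>
      intro r hr
      rw [pow_succ', mul_assoc] at hr
      exact ih r (hR _ hr)
  funext j
  induction j using WellFoundedLT.induction with
  | _ j ih =>
    have hj := h j
    rw [wittPoly, wittPoly, ← Finset.sum_erase_add _ _ (Finset.mem_Iic.mpr le_rfl),
      ← Finset.sum_erase_add _ (fun i : Fin m => (p : R) ^ (i : ℕ) * b i ^ p ^ ((j : ℕ) - (i : ℕ)))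
        (Finset.mem_Iic.mpr le_rfl),
      Finset.sum_congr rfl fun i hi => by
        rw [ih i (lt_of_le_of_ne (Finset.mem_Iic.mp (Finset.mem_of_mem_erase hi))
          (Finset.ne_of_mem_erase hi))], add_right_inj, Nat.sub_self, pow_zero, pow_one, pow_one,
      ← sub_eq_zero, ← mul_sub] at hj
    exact sub_eq_zero.mp (hpow _ _ hj)

theorem wittPoly_coeff (x : WittVector p R) (j : Fin (n + 1)) :
    wittPoly p (fun i : Fin (n + 1) => x.coeff i) j = WittVector.ghostComponent (j : ℕ) x := by
  rw [WittVector.ghostComponent_apply, aeval_wittPolynomial, wittPoly]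
  refine Finset.sum_nbij (fun i : Fin (n + 1) => (i : ℕ)) (fun i hi => ?_) (fun i _ i' _ h => Fin.ext h)
    (fun k hk => ?_) fun i _ => rfl
  · have hij : i ≤ j := Finset.mem_Iic.mp hi
    exact Finset.mem_range.mpr (Nat.lt_succ_of_le hij)
  · have hk' := Nat.le_of_lt_succ (Finset.mem_range.mp hk)
    exact ⟨⟨k, hk'.trans_lt j.2⟩, Finset.mem_coe.mpr (Finset.mem_Iic.mpr hk'), rfl⟩

/-- A `p`-typical Witt vector with the given initial components. -/
noncomputable def extend (a : Fin (n + 1) → R) : WittVector p R :=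
  (TruncatedWittVector.mk p a).out

omit hp in
theorem coeff_extend (a : Fin (n + 1) → R) (i : Fin (n + 1)) :
    (extend p n a).coeff i = a i := by
  rw [extend, TruncatedWittVector.coeff_out, TruncatedWittVector.coeff_mk]

theorem truncate_extend (a : Fin (n + 1) → R) :
    WittVector.truncate (n + 1) (extend p n a) = TruncatedWittVector.mk p a :=
  TruncatedWittVector.truncateFun_out _

theorem truncate_eq_mk (x : WittVector p R) :
    WittVector.truncate (n + 1) x = TruncatedWittVector.mk p fun i => x.coeff i := by
  ext i
  rw [WittVector.coeff_truncate, TruncatedWittVector.coeff_mk]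

omit hp [CommRing R] in
theorem mk_eq_mk_iff (a b : Fin (n + 1) → R) :
    TruncatedWittVector.mk p a = TruncatedWittVector.mk p b ↔ a = b :=
  ⟨fun h => funext fun i => congrArg (TruncatedWittVector.coeff i) h, fun h => h ▸ rfl⟩

/-- The factors are extended to full Witt vectors, on which the ghost components are ring
homomorphisms. The components up to n depend only on the truncation. -/
theorem wittPoly_mul_of_mk_mul {a b c : Fin (n + 1) → R}
    (h : TruncatedWittVector.mk p a * TruncatedWittVector.mk p b = TruncatedWittVector.mk p c)
    (j : Fin (n + 1)) : wittPoly p a j * wittPoly p b j = wittPoly p c j := by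
  rw [← truncate_extend, ← truncate_extend, ← map_mul, truncate_eq_mk, mk_eq_mk_iff] at h
  rw [← h, wittPoly_coeff, map_mul, ← wittPoly_coeff, ← wittPoly_coeff]
  simp only [coeff_extend]

theorem wittPoly_add_of_mk_add {a b c : Fin (n + 1) → R}
    (h : TruncatedWittVector.mk p a + TruncatedWittVector.mk p b = TruncatedWittVector.mk p c)
    (j : Fin (n + 1)) : wittPoly p a j + wittPoly p b j = wittPoly p c j := by
  rw [← truncate_extend, ← truncate_extend, ← map_add, truncate_eq_mk, mk_eq_mk_iff] at h
  rw [← h, wittPoly_coeff, map_add, ← wittPoly_coeff, ← wittPoly_coeff]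
  simp only [coeff_extend]

theorem truncate_map_extend (φ : R →+* S) (a : Fin (n + 1) → R) :
    WittVector.truncate (n + 1) (WittVector.map φ (extend p n a)) =
      TruncatedWittVector.mk p fun i => φ (a i) := by
  rw [truncate_eq_mk]
  simp only [WittVector.map_coeff, coeff_extend]

theorem mk_mul_map (φ : R →+* S) {a b c : Fin (n + 1) → R}
    (h : TruncatedWittVector.mk p a * TruncatedWittVector.mk p b = TruncatedWittVector.mk p c) :
    (TruncatedWittVector.mk p fun i => φ (a i)) * (TruncatedWittVector.mk p fun i => φ (b i)) =
      TruncatedWittVector.mk p fun i => φ (c i) := by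
  rw [← truncate_extend, ← truncate_extend, ← map_mul, truncate_eq_mk, mk_eq_mk_iff] at h
  rw [← truncate_map_extend, ← truncate_map_extend, ← map_mul, ← map_mul, truncate_eq_mk, ← h]
  simp only [WittVector.map_coeff]

theorem mk_add_map (φ : R →+* S) {a b c : Fin (n + 1) → R}
    (h : TruncatedWittVector.mk p a + TruncatedWittVector.mk p b = TruncatedWittVector.mk p c) :
    (TruncatedWittVector.mk p fun i => φ (a i)) + (TruncatedWittVector.mk p fun i => φ (b i)) =
      TruncatedWittVector.mk p fun i => φ (c i) := by
  rw [← truncate_extend, ← truncate_extend, ← map_add, truncate_eq_mk, mk_eq_mk_iff] at h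
  rw [← truncate_map_extend, ← truncate_map_extend, ← map_add, ← map_add, truncate_eq_mk, ← h]
  simp only [WittVector.map_coeff]

theorem eq_of_wittCoord_eq (hR : ∀ r : R, (p : R) * r = 0 → r = 0)
    {a b : Fin (n + 1) → R} (h : wittCoord p n a = wittCoord p n b) : a = b := by
  have := congrArg (wittGhost p n R) h
  rw [wittGhost_wittCoord, wittGhost_wittCoord, ghost_eq_iff] at this
  exact wittPoly_injective p hR this

/-- Both additions are governed by the Witt polynomials, and without p-torsion these determine the
coordinates. -/
theorem mk_add_of_wittCoord_add (hR : ∀ r : R, (p : R) * r = 0 → r = 0)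
    {a b c : Fin (n + 1) → R} (h : wittCoord p n a + wittCoord p n b = wittCoord p n c) :
    TruncatedWittVector.mk p a + TruncatedWittVector.mk p b = TruncatedWittVector.mk p c := by
  have h1 := congrArg (wittGhost p n R) h
  rw [map_add, wittGhost_wittCoord, wittGhost_wittCoord, wittGhost_wittCoord,
    ghost_add_eq_iff] at h1
  rw [← TruncatedWittVector.mk_coeff (TruncatedWittVector.mk p a + TruncatedWittVector.mk p b),
    mk_eq_mk_iff]
  refine wittPoly_injective p hR fun j => ?_
  rw [← h1]
  exact (wittPoly_add_of_mk_add p n (TruncatedWittVector.mk_coeff _).symm j).symm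

/-- The ring of integral polynomials on the underlying set of `R` surjects onto `R`. -/
theorem aeval_id_surjective (R : Type u) [CommRing R] :
    Function.Surjective (MvPolynomial.aeval (R := ℤ) (id : R → R)).toRingHom := fun r =>
  ⟨MvPolynomial.X r, by simp⟩

theorem eq_zero_of_prime_mul_eq_zero (X : Type u) (r : MvPolynomial X ℤ)
    (hr : (p : MvPolynomial X ℤ) * r = 0) : r = 0 :=
  (mul_eq_zero.mp hr).resolve_left (Nat.cast_ne_zero.mpr hp.out.ne_zero)

/-- Over ℤ[R] coordinates are unique and both additions agree. Passing to R, either quotient kills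
exactly the elements with coordinates in the kernel of ℤ[R] → R. -/
theorem exists_addEquiv_truncatedWittVector (R : Type u) [CommRing R] :
    ∃ e : TypicalWitt R R p n ≃+ TruncatedWittVector p (n + 1) R,
      ∀ a, e (wittCoord p n a) = TruncatedWittVector.mk p a := by
  set ε := (MvPolynomial.aeval (R := ℤ) (id : R → R)).toRingHom
  have hsurj : Function.Surjective ε := aeval_id_surjective R
  have htf := eq_zero_of_prime_mul_eq_zero p R
  choose s hs using wittCoord_surjective p n (R := MvPolynomial R ℤ)
  let g : TypicalWitt (MvPolynomial R ℤ) (MvPolynomial R ℤ) p n →+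
      -- Here g reads off the coordinates over ℤ[R], which are unique, and reduces them to R.
      TruncatedWittVector p (n + 1) R :=
    AddMonoidHom.mk' (fun x => TruncatedWittVector.mk p fun i => ε (s x i)) fun x y =>
      (mk_add_map p n ε (mk_add_of_wittCoord_add p n htf (by rw [hs, hs, hs]))).symm
  have hg : ∀ a, g (wittCoord p n a) = TruncatedWittVector.mk p fun i => ε (a i) := fun a => by
    have : s (wittCoord p n a) = a := eq_of_wittCoord_eq p n htf (hs _)
    change (TruncatedWittVector.mk p fun i => ε (s (wittCoord p n a) i)) = _
    rw [this]
  choose t ht using id hsurj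
  obtain ⟨e, he⟩ := exists_addEquiv_of_ker_eq (TypicalWitt.map p n (BimodHom.ofRingHom ε)) g
    (map_surjective_of_surjective p n hsurj)
    (fun y => ⟨wittCoord p n fun i => t (y.coeff i), by
      rw [hg]
      simp only [ht, TruncatedWittVector.mk_coeff]⟩)
    (fun x => by
      obtain ⟨a, rfl⟩ := wittCoord_surjective p n x
      have h0 : (0 : TruncatedWittVector p (n + 1) R) = TruncatedWittVector.mk p 0 := by
        ext i
        rw [TruncatedWittVector.coeff_zero, TruncatedWittVector.coeff_mk, Pi.zero_apply]
      rw [map_eq_zero_iff p n hsurj, hg, h0, mk_eq_mk_iff, funext_iff]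
      refine ⟨fun ⟨b, hb, hab⟩ => ?_, fun h => ⟨a, h, rfl⟩⟩
      rw [eq_of_wittCoord_eq p n htf hab]
      exact hb)
  refine ⟨e, fun a => ?_⟩
  have h := he (wittCoord p n fun i => t (a i))
  rw [map_wittCoord, hg] at h
  simpa only [ht] using h

/-- The additive isomorphism with the truncated `p`-typical Witt vectors. -/
noncomputable def truncatedEquiv (R : Type u) [CommRing R] :
    TypicalWitt R R p n ≃+ TruncatedWittVector p (n + 1) R :=
  (exists_addEquiv_truncatedWittVector p n R).choose

theorem truncatedEquiv_wittCoord (a : Fin (n + 1) → R) :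
    truncatedEquiv p n R (wittCoord p n a) = TruncatedWittVector.mk p a :=
  (exists_addEquiv_truncatedWittVector p n R).choose_spec a

/-- The product on `W_{⟨p^n⟩}(R;R)` for a commutative ring `R`. -/
noncomputable def wittMul (R : Type u) [CommRing R] :
    TypicalWitt R R p n →+ TypicalWitt R R p n →+ TypicalWitt R R p n :=
  AddMonoidHom.mk' (fun x => (truncatedEquiv p n R).symm.toAddMonoidHom.comp
    ((AddMonoidHom.mulLeft (truncatedEquiv p n R x)).comp (truncatedEquiv p n R).toAddMonoidHom))
    fun x y => by
      ext z
      simp [add_mul]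

theorem truncatedEquiv_wittMul (x y : TypicalWitt R R p n) :
    truncatedEquiv p n R (wittMul p n R x y) = truncatedEquiv p n R x * truncatedEquiv p n R y :=
  (truncatedEquiv p n R).apply_symm_apply _

theorem wittMul_wittCoord_iff (a b c : Fin (n + 1) → R) :
    wittMul p n R (wittCoord p n a) (wittCoord p n b) = wittCoord p n c ↔
      TruncatedWittVector.mk p a * TruncatedWittVector.mk p b = TruncatedWittVector.mk p c := by
  rw [← (truncatedEquiv p n R).injective.eq_iff, truncatedEquiv_wittMul, truncatedEquiv_wittCoord,
    truncatedEquiv_wittCoord, truncatedEquiv_wittCoord]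

theorem isWittProduct_wittMul : IsWittProduct.{u} p n fun R _ => wittMul p n R where
  natural R S _ _ f x y := by
    obtain ⟨a, rfl⟩ := wittCoord_surjective p n x
    obtain ⟨b, rfl⟩ := wittCoord_surjective p n y
    obtain ⟨c, hc⟩ := wittCoord_surjective p n
      (wittMul p n R (wittCoord p n a) (wittCoord p n b))
    rw [← hc, map_wittCoord, map_wittCoord, map_wittCoord]
    exact ((wittMul_wittCoord_iff p n _ _ _).mpr
      (mk_mul_map p n f ((wittMul_wittCoord_iff p n _ _ _).mp hc.symm))).symm
  ghost_mul R _ a b c h := wittPoly_mul_of_mk_mul p n ((wittMul_wittCoord_iff p n a b c).mp h)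

/-- Both arguments lift to ℤ[R], which has no p-torsion. There the ghost components fix the
coordinates of the product, and naturality carries the equality down to R. -/
theorem IsWittProduct.unique {μ ν : ∀ (R : Type u) [CommRing R], TypicalWitt R R p n →+
      TypicalWitt R R p n →+ TypicalWitt R R p n}
    (hμ : IsWittProduct p n μ) (hν : IsWittProduct p n ν) : μ = ν := by
  funext R _
  refine AddMonoidHom.ext fun x => AddMonoidHom.ext fun y => ?_
  obtain ⟨x, rfl⟩ := map_surjective_of_surjective p n (aeval_id_surjective R) x
  obtain ⟨y, rfl⟩ := map_surjective_of_surjective p n (aeval_id_surjective R) y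
  obtain ⟨a, rfl⟩ := wittCoord_surjective p n x
  obtain ⟨b, rfl⟩ := wittCoord_surjective p n y
  obtain ⟨c, hc⟩ := wittCoord_surjective p n
    (μ (MvPolynomial R ℤ) (wittCoord p n a) (wittCoord p n b))
  obtain ⟨d, hd⟩ := wittCoord_surjective p n
    (ν (MvPolynomial R ℤ) (wittCoord p n a) (wittCoord p n b))
  have hcd : c = d := wittPoly_injective p (eq_zero_of_prime_mul_eq_zero p R) fun j =>
    (hμ.ghost_mul _ a b c hc.symm j).symm.trans (hν.ghost_mul _ a b d hd.symm j)
  exact (hμ.natural _ _ _ _ _).symm.trans ((congrArg _ (hc.symm.trans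
    ((congrArg _ hcd).trans hd))).trans (hν.natural _ _ _ _ _))

end Product

end NCWitt

theorem mainTheorem8 (p : ℕ) [Fact p.Prime] (n : ℕ) :
    (∃ e : ∀ (R : Type u) [Ring R],
        NCWitt.TypicalWitt R R p n ≃+ NCWitt.HesselholtWitt p (n + 1) R,
      ∀ (R S : Type u) [Ring R] [Ring S] (f : R →+* S) (x : NCWitt.TypicalWitt R R p n),
        NCWitt.HesselholtWitt.map p (n + 1) f (e R x) =
          e S (NCWitt.TypicalWitt.map p n (NCWitt.BimodHom.ofRingHom f) x)) ∧
    (∃ μ : ∀ (R : Type u) [CommRing R], NCWitt.TypicalWitt R R p n →+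
        NCWitt.TypicalWitt R R p n →+ NCWitt.TypicalWitt R R p n,
      NCWitt.IsWittProduct p n μ ∧
      (∀ μ' : ∀ (R : Type u) [CommRing R], NCWitt.TypicalWitt R R p n →+
          NCWitt.TypicalWitt R R p n →+ NCWitt.TypicalWitt R R p n,
        NCWitt.IsWittProduct p n μ' → μ' = μ) ∧
      ∀ (R : Type u) [CommRing R],
        ∃ e : NCWitt.TypicalWitt R R p n ≃+ TruncatedWittVector p (n + 1) R,
          ∀ x y, e (μ R x y) = e x * e y) := by
  refine ⟨?_, fun R _ => NCWitt.wittMul p n R, NCWitt.isWittProduct_wittMul p n,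
    fun μ' h => h.unique p n (NCWitt.isWittProduct_wittMul p n),
    fun R _ => ⟨NCWitt.truncatedEquiv p n R, NCWitt.truncatedEquiv_wittMul p n⟩⟩
  choose e he using fun (R : Type u) [Ring R] => NCWitt.exists_addEquiv_hesselholtWitt p n R
  refine ⟨fun R _ => e R, fun R S _ _ f x => ?_⟩
  obtain ⟨b, rfl⟩ := NCWitt.wittCoord_surjective p n x
  choose s hs using NCWitt.counit_surjective R
  -- Once the coordinates are written as images from the free ring, both sides of the naturality
  -- square are classes of the same sequence over ℤ{S}, up to the counit.
  have hb : b = fun i => NCWitt.counit R (s (b i)) := funext fun i => (hs _).symm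
  rw [hb, he, NCWitt.map_hesselholtClass, NCWitt.map_wittCoord, ← he]
  simp only [NCWitt.counit_freeMap]
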